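/- An $(n,v,m)$-multigraph is a finite multigraph, with its edges coloured with $n$ colours, such that the edges of each colour span a disjoint union of non-trivial cliques (complete simple graphs on at least two vertices) that have in total at least $v$ vertices, and such that every pair of vertices is joined by at most $m$ edges (counting all colours). A rainbow matching is a set of pairwise vertex-disjoint edges with pairwise distinct colours. **Theorem.** There is an integer $n_0$ such that for every integer $n \ge n_0$ and every integer $m \ge 0$, every $(n,\,2n+2m+n^{3/4},\,m)$-multigraph contains a rainbow matching of size at least $n - \dfrac{1001\,n}{\sqrt{\log n}}$ (natural logarithm). -/

import Mathlib

open scoped Graph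

/-- The colour class of `i`: the spanning subgraph of the multigraph `G` whose edges are the
edges of `G` that receive the colour `i` under the edge-colouring `c`. -/
def Graph.colourClass {α β κ : Type*} (G : Graph α β) (c : β → κ) (i : κ) : Graph α β :=
  G.restrict {e | c e = i}

/-- The vertices of `H` that are spanned by its edges, i.e. the non-isolated vertices. -/
def Graph.spannedVerts {α β : Type*} (H : Graph α β) : Set α := {x | ∃ e, H.Inc e x}

/-- The edges of `H` span a disjoint union of non-trivial cliques: `H` has no loops and no
parallel edges, and there is a family `P` of pairwise disjoint vertex sets, with at least two
vertices each, such that two vertices are adjacent exactly when they are distinct and lie in a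
common member of `P`. -/
def Graph.IsDisjointUnionOfCliques {α β : Type*} (H : Graph α β) : Prop :=
  H.Simple ∧ ∃ P : Set (Set α), P.PairwiseDisjoint id ∧ (∀ S ∈ P, S.Nontrivial) ∧
    ∀ x y, H.Adj x y ↔ x ≠ y ∧ ∃ S ∈ P, x ∈ S ∧ y ∈ S

/-- The finite multigraph `G`, with its edges coloured by `c` with `n` colours, is an
`(n, v)`-multigraph: the edges of each colour span a disjoint union of non-trivial cliques that
have in total at least `v` vertices. -/
structure Graph.IsColouredCliqueMultigraph {α β : Type*} (G : Graph α β) {n : ℕ}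
    (c : β → Fin n) (v : ℝ) : Prop where
  finite_vertexSet : V(G).Finite
  cliques : ∀ i, (G.colourClass c i).IsDisjointUnionOfCliques
  le_card : ∀ i, v ≤ ((G.colourClass c i).spannedVerts.ncard : ℝ)

/-- Every pair of vertices is joined by at most `m` edges. -/
def Graph.MultiplicityAtMost {α β : Type*} (G : Graph α β) (m : ℕ) : Prop :=
  ∀ x y, {e | G.IsLink e x y}.encard ≤ m

/-- `M` is a rainbow matching of `G`: a set of edges no two of which share a vertex and no two
of which have the same colour. -/
structure Graph.IsRainbowMatching {α β κ : Type*} (G : Graph α β) (c : β → κ) (M : Set β) :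
    Prop where
  subset_edgeSet : M ⊆ E(G)
  disjoint : ∀ e ∈ M, ∀ f ∈ M, e ≠ f → ∀ x, G.Inc e x → ¬ G.Inc f x
  rainbow : Set.InjOn c M

/-! Take a maximum rainbow matching `M` of size n - k. A switch frees a colour c: it replaces `M` by
a rainbow matching at least as large that avoids c and differs from `M` only inside a small set of
vertices and colours, the home of c. A stage is a set C of freeable colours whose homes are small
and overlap little. The k missing colours form a first stage (`isStage_missing`), and every round
adds at least k/4 colours. With X = ⌈√log n⌉ and Xk ≥ 100n there would be X rounds, hence more than
n colours. So Xk < 100n, which gives the bound.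

A round works as follows. Let Out be the set of ends of the edges of `M` with colour outside C; it
has 2(n - |C|) vertices. Each colour in C spans at least 2n + 2m vertices, so 2β of them avoid Out,
where β = |C| + m. Orienting every clique as a cycle gives each of these vertices v a dart from v to
its successor. A vertex is the start of at most β darts and the end of at most β, and a set K
contains at most β(|K| - 1) darts (`card_darts_inside_le`). A random sample T of the darts has the
same bounds with β replaced by B of order X^4, and after deletions it contains no short walk along
which homes conflict (`exists_sample`, `exists_conflict_family`, `IsStage.exists_sparse_darts`).

These bounds verify Tutte's condition for the graph formed by T, a clique on Out and some dummy
vertices joined to everything (`exists_involution_of_sparse`). Superimposing its perfect matching on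
`M` yields disjoint alternating paths that start at uncovered vertices. At least k of them end in
Out or at an uncovered vertex, and at least half of those are short (`exists_altPaths`). On a short
path all colours can be freed simultaneously and used for its darts (`exists_combined_switch`). A
path ending at an uncovered vertex would enlarge `M`; so it ends in Out and frees the colour of the
`M`-edge there (`IsAltPath.exists_switch`). Each such edge ends at most two paths, whence k/4 new
colours (`IsStage.exists_next`).

Homes and their overlap grow by factors polynomial in X per round, so all error terms are exp(O(X
log X)), well below √n and hence below k. -/

section Sampling

/-! ### Random subsets: exponential moments and alteration. -/

open scoped Classical
open Finset

/-- The expectation of `f T`, where `T` is a random subset of `Ω` that contains each element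
independently with probability `p`. -/
noncomputable def binExp {ι : Type*} (Ω : Finset ι) (p : ℝ) (f : Finset ι → ℝ) : ℝ :=
  ∑ T ∈ Ω.powerset, p ^ #T * (1 - p) ^ #(Ω \ T) * f T

variable {ι : Type*} {Ω : Finset ι} {p : ℝ}

/-- Expanding the product of sums chooses one summand for each element, which is the same as
choosing a subset. The moments below are instances of this. -/
lemma binExp_prod (a b : ι → ℝ) :
    binExp Ω p (fun T => (∏ i ∈ T, a i) * ∏ i ∈ Ω \ T, b i) =
      ∏ i ∈ Ω, (p * a i + (1 - p) * b i) := by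
  rw [Finset.prod_add, binExp]
  refine Finset.sum_congr rfl fun T _ => ?_
  rw [Finset.prod_mul_distrib, Finset.prod_mul_distrib, Finset.prod_const, Finset.prod_const]
  ring

lemma binExp_add (f g : Finset ι → ℝ) :
    binExp Ω p (fun T => f T + g T) = binExp Ω p f + binExp Ω p g := by
  simp only [binExp, mul_add, Finset.sum_add_distrib]

lemma binExp_mul_const (f : Finset ι → ℝ) (r : ℝ) :
    binExp Ω p (fun T => f T * r) = binExp Ω p f * r := by
  simp only [binExp, Finset.sum_mul, mul_assoc]

lemma binExp_sum {J : Type*} (s : Finset J) (f : J → Finset ι → ℝ) :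
    binExp Ω p (fun T => ∑ j ∈ s, f j T) = ∑ j ∈ s, binExp Ω p (f j) := by
  simp only [binExp, Finset.mul_sum]
  rw [Finset.sum_comm]

lemma binExp_const (r : ℝ) : binExp Ω p (fun _ => r) = r := by
  have h := binExp_prod (Ω := Ω) (p := p) (fun _ => 1) (fun _ => 1)
  have h2 := binExp_mul_const (Ω := Ω) (p := p) (fun _ => 1) r
  simp only [Finset.prod_const_one, mul_one, one_mul] at h h2
  rw [h2, h]
  simp

lemma exists_lt_of_binExp_lt (hp : 0 ≤ p) (hp1 : p ≤ 1) {f : Finset ι → ℝ} {r : ℝ}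
    (h : binExp Ω p f < r) : ∃ T ⊆ Ω, f T < r := by
  by_contra! hcon
  have h1 : binExp Ω p (fun _ => r) ≤ binExp Ω p f := by
    refine Finset.sum_le_sum fun T hT => ?_
    exact mul_le_mul_of_nonneg_left (hcon T (Finset.mem_powerset.1 hT))
      (mul_nonneg (pow_nonneg hp _) (pow_nonneg (by linarith) _))
  rw [binExp_const] at h1
  linarith

lemma binExp_subset {F : Finset ι} (hF : F ⊆ Ω) :
    binExp Ω p (fun T => if F ⊆ T then 1 else 0) = p ^ #F := by
  have h := binExp_prod (Ω := Ω) (p := p) (fun _ => 1) (fun i => if i ∈ F then 0 else 1)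
  have h1 : (fun T : Finset ι => (∏ i ∈ T, (1 : ℝ)) * ∏ i ∈ Ω \ T, if i ∈ F then (0 : ℝ) else 1)
      = fun T => if F ⊆ T then 1 else 0 := by
    funext T
    rw [Finset.prod_const_one, one_mul]
    split_ifs with hFT
    · refine Finset.prod_eq_one fun i hi => ?_
      rw [if_neg fun hiF => (Finset.mem_sdiff.1 hi).2 (hFT hiF)]
    · obtain ⟨i, hi, hiT⟩ := Finset.not_subset.1 hFT
      exact Finset.prod_eq_zero (i := i) (Finset.mem_sdiff.2 ⟨hF hi, hiT⟩) (if_pos hi)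
  rw [h1] at h
  rw [h, ← Finset.prod_sdiff hF]
  rw [Finset.prod_eq_one, one_mul, Finset.prod_congr rfl (g := fun _ => p), Finset.prod_const]
  · intro i hi; simp [hi]
  · intro i hi; simp [(Finset.mem_sdiff.1 hi).2]

lemma binExp_exp_card {F : Finset ι} (hF : F ⊆ Ω) (θ : ℝ) :
    binExp Ω p (fun T => Real.exp (θ * #(T ∩ F))) = (p * Real.exp θ + (1 - p)) ^ #F := by
  have h := binExp_prod (Ω := Ω) (p := p) (fun i => if i ∈ F then Real.exp θ else 1) (fun _ => 1)
  have h1 : (fun T : Finset ι => (∏ i ∈ T, if i ∈ F then Real.exp θ else 1) *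
      ∏ i ∈ Ω \ T, (1 : ℝ)) = fun T => Real.exp (θ * #(T ∩ F)) := by
    funext T
    rw [Finset.prod_const_one, mul_one, Finset.prod_ite_mem, Finset.prod_const, ← Real.exp_nat_mul]
    ring_nf
  rw [h1] at h
  rw [h, ← Finset.prod_sdiff hF]
  rw [Finset.prod_eq_one, one_mul, Finset.prod_congr rfl
    (g := fun _ => p * Real.exp θ + (1 - p)), Finset.prod_const]
  · intro i hi; simp [hi]
  · intro i hi; simp [(Finset.mem_sdiff.1 hi).2]

/-- Follows from e^θ ≤ 1 + θ + θ² for |θ| ≤ 1. Positive θ serves the upper tail and negative θ the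
lower tail. -/
lemma binExp_exp_card_le (hp : 0 ≤ p) (hp1 : p ≤ 1) {F : Finset ι} (hF : F ⊆ Ω) {θ : ℝ}
    (hθ : |θ| ≤ 1) :
    binExp Ω p (fun T => Real.exp (θ * #(T ∩ F))) ≤ Real.exp (p * #F * (θ + θ ^ 2)) := by
  rw [binExp_exp_card hF]
  have h1 := Real.abs_exp_sub_one_sub_id_le hθ
  have h2 : Real.exp θ ≤ 1 + θ + θ ^ 2 := by have := (abs_le.1 h1).2; linarith
  have h3 : p * Real.exp θ + (1 - p) ≤ Real.exp (p * (θ + θ ^ 2)) := by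
    have := Real.add_one_le_exp (p * (θ + θ ^ 2))
    nlinarith [mul_le_mul_of_nonneg_left h2 hp]
  have h4 : 0 ≤ p * Real.exp θ + (1 - p) := by
    have := mul_nonneg hp (Real.exp_pos θ).le
    linarith
  calc _ ≤ Real.exp (p * (θ + θ ^ 2)) ^ #F := pow_le_pow_left₀ h4 h3 _
    _ = _ := by rw [← Real.exp_nat_mul]; ring_nf

/-- A random sample can be chosen that meets every set of a prescribed family in not much more
than the expected number of elements, is not much smaller than expected, and contains none of the
sets of another family. -/
theorem exists_sample (hp : 0 < p) (hp1 : p ≤ 1) {δ τ : ℝ} (hδ : 0 < δ) (hδ1 : δ ≤ 1)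
    (hΩ : Ω.Nonempty) (𝓕 : Finset (Finset ι × ℕ))
    (hF : ∀ x ∈ 𝓕, x.1 ⊆ Ω ∧ p * #x.1 ≤ τ * x.2)
    (h1 : ∑ x ∈ 𝓕, Real.exp (-(δ ^ 2 * τ * x.2)) ≤ 1 / 4)
    (h2 : Real.exp (-(δ ^ 2 * (p * #Ω))) ≤ 1 / 4)
    (𝓑 : Finset (Finset ι)) (hB : ∀ F ∈ 𝓑, F.Nonempty ∧ F ⊆ Ω)
    (h3 : ∑ F ∈ 𝓑, p ^ #F ≤ 1 / 4 * (δ * (p * #Ω))) :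
    ∃ T ⊆ Ω, (∀ x ∈ 𝓕, (#(T ∩ x.1) : ℝ) ≤ τ * (1 + 2 * δ) * x.2) ∧
      (1 - 3 * δ) * (p * #Ω) ≤ #T ∧ ∀ F ∈ 𝓑, ¬ F ⊆ T := by
  set μ : ℝ := p * #Ω with hμ
  have hΩ0 : (0 : ℝ) < #Ω := by exact_mod_cast hΩ.card_pos
  have hμ0 : 0 < μ := mul_pos hp hΩ0
  have hδμ : 0 < δ * μ := mul_pos hδ hμ0
  -- Three penalties, each at least 1 when its requirement fails: a set of `𝓕` is met too often, T
  -- is smaller than (1 - 2δ)μ, or T contains at least δμ sets of `𝓑`. Their expectations add up to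
  -- at most 3/4, so some T has all three below 1.
  let f1 : Finset ι → ℝ := fun T => ∑ x ∈ 𝓕, Real.exp (δ * #(T ∩ x.1)) *
    Real.exp (-(δ * (τ * (1 + 2 * δ) * x.2)))
  let f2 : Finset ι → ℝ := fun T => Real.exp (-δ * #(T ∩ Ω)) * Real.exp (δ * (μ * (1 - 2 * δ)))
  let f3 : Finset ι → ℝ := fun T => (∑ F ∈ 𝓑, if F ⊆ T then (1 : ℝ) else 0) * (δ * μ)⁻¹
  have e1 : binExp Ω p f1 ≤ 1 / 4 := by
    refine le_trans ?_ h1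
    rw [binExp_sum]
    refine Finset.sum_le_sum fun x hx => ?_
    rw [binExp_mul_const]
    refine (mul_le_mul_of_nonneg_right (binExp_exp_card_le hp.le hp1 (hF x hx).1
      (by rw [abs_of_pos hδ]; exact hδ1)) (Real.exp_pos _).le).trans ?_
    rw [← Real.exp_add]
    refine Real.exp_le_exp.2 ?_
    have := mul_le_mul_of_nonneg_right (hF x hx).2 (by positivity : 0 ≤ δ + δ ^ 2)
    nlinarith
  have e2 : binExp Ω p f2 ≤ 1 / 4 := by
    refine le_trans ?_ h2
    rw [binExp_mul_const]
    refine (mul_le_mul_of_nonneg_right (binExp_exp_card_le hp.le hp1 (subset_refl Ω)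
      (by rw [abs_neg, abs_of_pos hδ]; exact hδ1)) (Real.exp_pos _).le).trans ?_
    rw [← Real.exp_add]
    refine Real.exp_le_exp.2 ?_
    rw [← hμ]
    nlinarith
  have e3 : binExp Ω p f3 ≤ 1 / 4 := by
    rw [binExp_mul_const, binExp_sum, Finset.sum_congr rfl fun F hF => binExp_subset (hB F hF).2]
    rw [← div_eq_mul_inv, div_le_iff₀ hδμ]
    exact h3
  have e : binExp Ω p (fun T => (f1 T + f2 T) + f3 T) < 1 := by
    rw [binExp_add, binExp_add]
    linarith
  obtain ⟨T, hT, hTf⟩ := exists_lt_of_binExp_lt hp.le hp1 e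
  have n1 : 0 ≤ f1 T := Finset.sum_nonneg fun _ _ => by positivity
  have n2 : 0 ≤ f2 T := by positivity
  have n3 : 0 ≤ f3 T :=
    mul_nonneg (Finset.sum_nonneg fun _ _ => by split_ifs <;> norm_num) (inv_nonneg.2 hδμ.le)
  have hpick : ∀ F : Finset ι, ∃ i, F ∈ 𝓑 → i ∈ F := fun F => by
    by_cases hF : F ∈ 𝓑
    · obtain ⟨i, hi⟩ := (hB F hF).1
      exact ⟨i, fun _ => hi⟩
    · exact ⟨hΩ.choose, fun h => absurd h hF⟩
  choose pick hpick using hpick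
  -- Alteration: one element is deleted from every bad set inside T. This costs fewer than δμ
  -- elements and turns 1 - 2δ into 1 - 3δ.
  set R := (𝓑.filter (· ⊆ T)).image pick with hR
  have hRcard : (#R : ℝ) < δ * μ := by
    have hf3 : f3 T < 1 := by linarith
    have : (∑ F ∈ 𝓑, if F ⊆ T then (1 : ℝ) else 0) = #(𝓑.filter (· ⊆ T)) := by
      rw [Finset.sum_boole]
    have h5 : (#(𝓑.filter (· ⊆ T)) : ℝ) < δ * μ := by
      rw [← this]
      have := hf3
      simp only [f3] at this
      rwa [← div_eq_mul_inv, div_lt_one hδμ] at this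
    refine lt_of_le_of_lt ?_ h5
    exact_mod_cast Finset.card_image_le
  refine ⟨T \ R, sdiff_subset.trans hT, fun x hx => ?_, ?_, fun F hF hFT => ?_⟩
  · have h5 : Real.exp (δ * #(T ∩ x.1)) * Real.exp (-(δ * (τ * (1 + 2 * δ) * x.2))) ≤ f1 T :=
      Finset.single_le_sum (f := fun x : Finset ι × ℕ => Real.exp (δ * #(T ∩ x.1)) *
        Real.exp (-(δ * (τ * (1 + 2 * δ) * x.2)))) (fun _ _ => by positivity) hx
    have h6 : Real.exp (δ * #(T ∩ x.1) + -(δ * (τ * (1 + 2 * δ) * x.2))) < 1 := by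
      rw [Real.exp_add]; linarith
    rw [Real.exp_lt_one_iff] at h6
    have h7 : δ * (#(T ∩ x.1) : ℝ) ≤ δ * (τ * (1 + 2 * δ) * x.2) := by linarith
    have h8 := le_of_mul_le_mul_left h7 hδ
    refine le_trans ?_ h8
    exact_mod_cast Finset.card_le_card (Finset.inter_subset_inter_right sdiff_subset)
  · have h5 : Real.exp (-δ * #(T ∩ Ω) + δ * (μ * (1 - 2 * δ))) < 1 := by
      rw [Real.exp_add]
      have : f2 T < 1 := by linarith
      exact this
    rw [Real.exp_lt_one_iff, Finset.inter_eq_left.2 hT] at h5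
    have h7 : δ * (μ * (1 - 2 * δ)) ≤ δ * (#T : ℝ) := by linarith
    have h8 := le_of_mul_le_mul_left h7 hδ
    have h9 : (#T : ℝ) ≤ #(T \ R) + #R := by
      exact_mod_cast (Finset.card_le_card (by intro i hi; by_cases h : i ∈ R <;> simp [h, hi])).trans
        (Finset.card_union_le (T \ R) R)
    linarith
  · have hFT' : F ⊆ T := hFT.trans sdiff_subset
    have h5 : pick F ∈ R := Finset.mem_image_of_mem _ (Finset.mem_filter.2 ⟨hF, hFT'⟩)
    exact (Finset.mem_sdiff.1 (hFT (hpick F hF))).2 h5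

end Sampling

/-! ### Tutte's theorem for the graph of sparse darts, a clique and dummy vertices. -/

section Tutte

open scoped Classical
open Finset

variable {V κ : Type*}

/-- The dart `g = (c, v)` stands for the edge of colour `c` between `v` and `π c v`;
it joins `a` and `b` if these are its two ends, in some order. -/
def DartJoins (π : κ → Equiv.Perm V) (g : κ × V) (a b : V) : Prop :=
  (g.2 = a ∧ π g.1 a = b) ∨ (g.2 = b ∧ π g.1 b = a)

lemma DartJoins.symm {π : κ → Equiv.Perm V} {g : κ × V} {a b : V} (h : DartJoins π g a b) :
    DartJoins π g b a := Or.symm h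

/-- The graph formed by the darts in `T`, a clique on `Out`, and `d` new vertices that are joined
to everything. -/
def dartGraph (π : κ → Equiv.Perm V) (T : Finset (κ × V)) (Out : Finset V) (d : ℕ) :
    SimpleGraph (V ⊕ Fin d) where
  Adj x y := x ≠ y ∧ ∀ a b, x = Sum.inl a → y = Sum.inl b →
    (∃ g ∈ T, DartJoins π g a b) ∨ (a ∈ Out ∧ b ∈ Out)
  symm := ⟨fun x y h => ⟨h.1.symm, fun a b ha hb => by
    rcases h.2 b a hb ha with ⟨g, hg, hj⟩ | ⟨h1, h2⟩
    · exact Or.inl ⟨g, hg, hj.symm⟩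
    · exact Or.inr ⟨h2, h1⟩⟩⟩
  loopless := ⟨fun x h => h.1 rfl⟩

variable [Fintype V]

/-- Counting the darts along a partition of `Aᶜ` into classes that are not joined by darts. -/
lemma card_add_mul_card_classes_le {π : κ → Equiv.Perm V} {T : Finset (κ × V)} {Out : Finset V}
    {B : ℕ} (hT : ∀ g ∈ T, g.2 ∉ Out)
    (hout : ∀ v, #(T.filter fun g => g.2 = v) ≤ B)
    (hin : ∀ v, #(T.filter fun g => π g.1 g.2 = v) ≤ B)
    (hK : ∀ K : Finset V, K.Nonempty → Disjoint K Out →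
      #(T.filter fun g => g.2 ∈ K ∧ π g.1 g.2 ∈ K) ≤ B * (#K - 1))
    (A : Finset V) {J : Type*} [Fintype J] (K : J → Finset V) (hKne : ∀ j, (K j).Nonempty)
    (hKA : ∀ j, Disjoint (K j) A) (hKdisj : ∀ i j, i ≠ j → Disjoint (K i) (K j))
    (hTK : ∀ g ∈ T, g.2 ∉ A → π g.1 g.2 ∉ A → ∃ j, g.2 ∈ K j ∧ π g.1 g.2 ∈ K j)
    (hOut : ∀ i j, ¬ Disjoint (K i) Out → ¬ Disjoint (K j) Out → i = j) :
    #T + B * Fintype.card J + B * #Out ≤ B * Fintype.card V + B * #A + B := by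
  have c1 : #(T.filter fun g => g.2 ∈ A) ≤ B * #(A \ Out) := by
    refine (Finset.card_le_mul_card_image (f := fun g => g.2) _ B fun v _ => ?_).trans ?_
    · refine le_trans (Finset.card_le_card ?_) (hout v)
      intro g; simp only [mem_filter]; tauto
    · refine Nat.mul_le_mul_left _ (Finset.card_le_card ?_)
      intro v
      simp only [mem_image, mem_filter, mem_sdiff]
      rintro ⟨g, ⟨hg, hA⟩, rfl⟩
      exact ⟨hA, hT g hg⟩
  have c2 : #(T.filter fun g => π g.1 g.2 ∈ A) ≤ B * #A := by
    refine (Finset.card_le_mul_card_image (f := fun g => π g.1 g.2) _ B fun v _ => ?_).trans ?_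
    · refine le_trans (Finset.card_le_card ?_) (hin v)
      intro g; simp only [mem_filter]; tauto
    · refine Nat.mul_le_mul_left _ (Finset.card_le_card ?_)
      intro v
      simp only [mem_image, mem_filter]
      rintro ⟨g, ⟨hg, hA⟩, rfl⟩
      exact hA
  -- A class that avoids Out saves one B by the bound inside sets. A class that meets Out saves
  -- nothing, but its darts start only at vertices outside Out.
  have c3 : ∀ j, #(T.filter fun g => g.2 ∈ K j ∧ π g.1 g.2 ∈ K j) +
      B * (if Disjoint (K j) Out then 1 else 0) ≤ B * #(K j \ Out) := by
    intro j
    split_ifs with hd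
    · rw [sdiff_eq_left.2 hd]
      have h1 := hK (K j) (hKne j) hd
      have h2 := (hKne j).card_pos
      calc _ ≤ B * (#(K j) - 1) + B * 1 := by gcongr
        _ = _ := by rw [← Nat.mul_add]; congr 1; omega
    · rw [mul_zero, add_zero]
      refine (Finset.card_le_mul_card_image (f := fun g => g.2) _ B fun v _ => ?_).trans ?_
      · refine le_trans (Finset.card_le_card ?_) (hout v)
        intro g; simp only [mem_filter]; tauto
      · refine Nat.mul_le_mul_left _ (Finset.card_le_card ?_)
        intro v
        simp only [mem_image, mem_filter, mem_sdiff]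
        rintro ⟨g, ⟨hg, hA⟩, rfl⟩
        exact ⟨hA.1, hT g hg⟩
  have c4 : #T ≤ #(T.filter fun g => g.2 ∈ A) + #(T.filter fun g => π g.1 g.2 ∈ A) +
      ∑ j, #(T.filter fun g => g.2 ∈ K j ∧ π g.1 g.2 ∈ K j) := by
    have : T ⊆ ((T.filter fun g => g.2 ∈ A) ∪ (T.filter fun g => π g.1 g.2 ∈ A)) ∪
        univ.biUnion fun j => T.filter fun g => g.2 ∈ K j ∧ π g.1 g.2 ∈ K j := by
      intro g hg
      simp only [mem_union, mem_filter, mem_biUnion, mem_univ, true_and]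
      by_cases h1 : g.2 ∈ A
      · exact Or.inl (Or.inl ⟨hg, h1⟩)
      by_cases h2 : π g.1 g.2 ∈ A
      · exact Or.inl (Or.inr ⟨hg, h2⟩)
      obtain ⟨j, hj⟩ := hTK g hg h1 h2
      exact Or.inr ⟨j, hg, hj⟩
    refine (card_le_card this).trans ((card_union_le _ _).trans ?_)
    exact Nat.add_le_add (card_union_le _ _) card_biUnion_le
  have c5 : ∑ j, #(K j \ Out) ≤ #(Aᶜ \ Out) := by
    rw [← card_biUnion]
    · refine card_le_card ?_
      intro v
      simp only [mem_biUnion, mem_univ, true_and, mem_sdiff, mem_compl]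
      rintro ⟨j, hj, ho⟩
      exact ⟨Finset.disjoint_left.1 (hKA j) hj, ho⟩
    · intro i _ j _ hij
      exact (hKdisj i j hij).mono sdiff_subset sdiff_subset
  -- Only one class can meet Out; it accounts for the extra B on the right of the conclusion.
  have c6 : Fintype.card J ≤ (∑ j, if Disjoint (K j) Out then 1 else 0) + 1 := by
    have h1 : ∑ j, (if Disjoint (K j) Out then 1 else 0) =
        #(univ.filter fun j => Disjoint (K j) Out) := by simp
    have h2 : #(univ.filter fun j => ¬ Disjoint (K j) Out) ≤ 1 := by
      rw [Finset.card_le_one]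
      intro i hi j hj
      exact hOut i j (mem_filter.1 hi).2 (mem_filter.1 hj).2
    rw [h1, ← Finset.card_univ,
      ← Finset.card_filter_add_card_filter_not (s := univ) (fun j => Disjoint (K j) Out)]
    omega
  have c7 : #(A \ Out) + #(Aᶜ \ Out) + #Out = Fintype.card V := by
    rw [← Finset.card_univ (α := V), ← card_union_of_disjoint, ← card_union_of_disjoint]
    · congr 1
      ext v
      simp only [mem_union, mem_sdiff, mem_compl, mem_univ, iff_true]
      tauto
    · rw [Finset.disjoint_left]; intro v
      simp only [mem_union, mem_sdiff, mem_compl]; tauto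
    · rw [Finset.disjoint_left]; intro v
      simp only [mem_sdiff, mem_compl]; tauto
  have c8 := Finset.sum_le_sum fun j (_ : j ∈ (univ : Finset J)) => c3 j
  rw [Finset.sum_add_distrib, ← Finset.mul_sum, ← Finset.mul_sum] at c8
  have c9 := Nat.mul_le_mul_left B c5
  have c10 := Nat.mul_le_mul_left B c6
  have c11 := congrArg (B * ·) c7
  simp only [Nat.mul_add, mul_one] at c10 c11
  omega

/-- A sparse set of darts satisfying local density bounds, together with a clique on `Out` and
sufficiently many new vertices, has a perfect matching. -/
theorem exists_involution_of_sparse {π : κ → Equiv.Perm V} {T : Finset (κ × V)} {Out : Finset V}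
    {B d : ℕ} (hB : 0 < B) (hT : ∀ g ∈ T, g.2 ∉ Out)
    (hout : ∀ v, #(T.filter fun g => g.2 = v) ≤ B)
    (hin : ∀ v, #(T.filter fun g => π g.1 g.2 = v) ≤ B)
    (hK : ∀ K : Finset V, K.Nonempty → Disjoint K Out →
      #(T.filter fun g => g.2 ∈ K ∧ π g.1 g.2 ∈ K) ≤ B * (#K - 1))
    (hd : B * (Fintype.card V + 1) ≤ #T + B * d + B * #Out)
    (hpar : Even (Fintype.card V + d)) :
    ∃ N : V ⊕ Fin d → V ⊕ Fin d, Function.Involutive N ∧ (∀ x, N x ≠ x) ∧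
      ∀ u x, u ∉ Out → N (Sum.inl u) = Sum.inl x → ∃ g ∈ T, DartJoins π g u x := by
  set G := dartGraph π T Out d with hG
  obtain ⟨M, hM⟩ : ∃ M : G.Subgraph, M.IsPerfectMatching := by
    rw [SimpleGraph.tutte]
    intro u hu
    rw [SimpleGraph.IsTutteViolator] at hu
    set H := ((⊤ : G.Subgraph).deleteVerts u).coe with hH
    have hvert : ∀ x, x ∉ u → x ∈ ((⊤ : G.Subgraph).deleteVerts u).verts := fun x hx => by
      simp [hx]
    have hnot : ∀ x : ((⊤ : G.Subgraph).deleteVerts u).verts, x.1 ∉ u := fun x => by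
      have := x.2
      simpa using this
    have hadj : ∀ x y : ((⊤ : G.Subgraph).deleteVerts u).verts, G.Adj x.1 y.1 → H.Adj x y := by
      intro x y h
      simp [hH, hnot x, hnot y, h]
    -- A surviving dummy vertex connects everything. A violator is then empty and the single
    -- component odd, against parity.
    by_cases hdum : ∃ i : Fin d, Sum.inr i ∉ u
    · obtain ⟨i, hi⟩ := hdum
      let z : ((⊤ : G.Subgraph).deleteVerts u).verts := ⟨Sum.inr i, hvert _ hi⟩
      have hz : ∀ x, H.Reachable x z := by
        intro x
        by_cases hx : x = z
        · rw [hx]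
        · refine (hadj x z ⟨fun h => hx (Subtype.ext h), fun a b _ hb => ?_⟩).reachable
          simp [z] at hb
      have hsub : ∀ c c' : H.ConnectedComponent, c = c' := by
        intro c c'
        induction c using SimpleGraph.ConnectedComponent.ind with | _ x
        induction c' using SimpleGraph.ConnectedComponent.ind with | _ y
        exact SimpleGraph.ConnectedComponent.sound ((hz x).trans (hz y).symm)
      have h1 : H.oddComponents.ncard ≤ 1 := by
        rw [Set.ncard_le_one_iff]
        intro a b _ _
        exact hsub a b
      have hu0 : u.ncard = 0 := by omega
      have hu1 : u = ∅ := by rwa [Set.ncard_eq_zero] at hu0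
      obtain ⟨c, hc⟩ : H.oddComponents.Nonempty := by
        rw [← Set.ncard_pos]; omega
      have hsupp : c.supp = Set.univ := by
        ext x
        simp only [SimpleGraph.ConnectedComponent.mem_supp_iff, Set.mem_univ, iff_true]
        exact hsub _ _
      have hodd : Odd c.supp.ncard := hc
      rw [hsupp, Set.ncard_univ, Nat.card_congr (Equiv.subtypeUnivEquiv
        (fun x => hvert x (by simp [hu1]))), Nat.card_eq_fintype_card, Fintype.card_sum,
        Fintype.card_fin] at hodd
      exact (Nat.not_odd_iff_even.2 hpar) hodd
    -- Now `u` contains all d dummies, so a violation needs at least |A| + d + 1 components, which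
    -- the counting lemma and `hd` exclude.
    · push Not at hdum
      set A : Finset V := univ.filter fun v => Sum.inl v ∈ u with hA
      have hu2 : u.ncard = #A + d := by
        have : u = ((A.map ⟨Sum.inl, Sum.inl_injective⟩ ∪
            univ.map ⟨Sum.inr, Sum.inr_injective⟩ : Finset (V ⊕ Fin d)) : Set (V ⊕ Fin d)) := by
          ext x
          rcases x with v | i
          · simp [hA]
          · simp [hdum i]
        rw [this, Set.ncard_coe_finset, card_union_of_disjoint, card_map, card_map, card_univ,
          Fintype.card_fin]
        rw [Finset.disjoint_left]
        intro x
        simp only [mem_map, Function.Embedding.coeFn_mk]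
        rintro ⟨a, _, rfl⟩ ⟨i, _, hi⟩
        exact Sum.inr_ne_inl hi
      have hvA : ∀ v, v ∉ A → Sum.inl v ∉ u := fun v hv h => hv (by simp [hA, h])
      have : Fintype H.ConnectedComponent := Fintype.ofFinite _
      let cc : ∀ v, v ∉ A → H.ConnectedComponent := fun v hv =>
        H.connectedComponentMk ⟨Sum.inl v, hvert _ (hvA v hv)⟩
      have hccadj : ∀ a b (ha : a ∉ A) (hb : b ∉ A), ((∃ g ∈ T, DartJoins π g a b) ∨
          (a ∈ Out ∧ b ∈ Out)) → cc a ha = cc b hb := by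
        intro a b ha hb h
        by_cases hab : a = b
        · subst hab; rfl
        · refine SimpleGraph.ConnectedComponent.sound (SimpleGraph.Adj.reachable (hadj _ _ ?_))
          refine ⟨fun h => hab (Sum.inl_injective h), fun a' b' ha' hb' => ?_⟩
          rw [← Sum.inl_injective ha', ← Sum.inl_injective hb']
          exact h
      let K : H.ConnectedComponent → Finset V := fun c => univ.filter fun v => ∃ hv, cc v hv = c
      have hcount := card_add_mul_card_classes_le hT hout hin hK A K (J := H.ConnectedComponent)
        (by
          intro c
          induction c using SimpleGraph.ConnectedComponent.ind with | _ x
          obtain ⟨x, hx⟩ := x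
          rcases x with v | i
          · refine ⟨v, ?_⟩
            have hv : v ∉ A := fun h => hnot ⟨_, hx⟩ (by simpa [hA] using h)
            simp only [K, mem_filter, mem_univ, true_and]
            exact ⟨hv, rfl⟩
          · exact absurd (hdum i) (hnot ⟨_, hx⟩))
        (by
          intro c
          rw [Finset.disjoint_left]
          intro v hv
          simp only [K, mem_filter, mem_univ, true_and] at hv
          exact hv.1)
        (by
          intro c c' hcc
          rw [Finset.disjoint_left]
          intro v hv hv'
          simp only [K, mem_filter, mem_univ, true_and] at hv hv'
          obtain ⟨h1, h2⟩ := hv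
          obtain ⟨_, h3⟩ := hv'
          exact hcc (h2.symm.trans h3))
        (by
          intro g hg h1 h2
          refine ⟨cc g.2 h1, ?_, ?_⟩
          · exact mem_filter.2 ⟨mem_univ _, h1, rfl⟩
          · exact mem_filter.2 ⟨mem_univ _, h2, (hccadj _ _ h1 h2 (Or.inl ⟨g, hg, Or.inl ⟨rfl, rfl⟩⟩)).symm⟩)
        (by
          intro c c' h1 h2
          rw [Finset.not_disjoint_iff] at h1 h2
          obtain ⟨a, ha, hao⟩ := h1
          obtain ⟨b, hb, hbo⟩ := h2
          simp only [K, mem_filter, mem_univ, true_and] at ha hb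
          obtain ⟨ha, rfl⟩ := ha
          obtain ⟨hb, rfl⟩ := hb
          exact hccadj a b ha hb (Or.inr ⟨hao, hbo⟩))
      have h2 : H.oddComponents.ncard ≤ Fintype.card H.ConnectedComponent := by
        rw [← Nat.card_eq_fintype_card]
        exact Set.ncard_le_card _
      have h3 : #A + d + 1 ≤ Fintype.card H.ConnectedComponent := by omega
      have h4 := Nat.mul_le_mul_left B h3
      simp only [Nat.mul_add, mul_one] at h4 hd
      omega
  rw [SimpleGraph.Subgraph.isPerfectMatching_iff] at hM
  choose N hN hN' using hM
  refine ⟨N, fun x => ?_, fun x hx => ?_, fun u x hu hx => ?_⟩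
  · exact (hN' (N x) x (hN x).symm).symm
  · have := hN x
    simp only at this
    rw [hx] at this
    exact this.ne rfl
  · have h1 := (hN (Sum.inl u)).adj_sub
    rw [hx] at h1
    rcases h1.2 u x rfl rfl with h | h
    · exact h
    · exact absurd h.1 hu

end Tutte

/-! ### Alternating paths of two involutions. -/

section AlternatingPaths

open scoped Classical
open Finset

variable {Y : Type*} {N P : Y → Y}

/-- For involutions `N` and `P` and a fixed point `w` of `P`, the alternating path
`w, N w, P (N w), …` first reaches a further fixed point of `P` after its `t + 1`-st `N`-step. -/
def IsAltStop (N P : Y → Y) (w : Y) (t : ℕ) : Prop :=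
  (∀ j < t, P (N ((P ∘ N)^[j] w)) ≠ N ((P ∘ N)^[j] w)) ∧
    P (N ((P ∘ N)^[t] w)) = N ((P ∘ N)^[t] w)

/-- The injective map P ∘ N on a finite set returns to w. One step before the return, the `N`-image
y satisfies P y = w = P w, so y = w is fixed by P. -/
lemma exists_isAltStop [Finite Y] (hN : Function.Involutive N) (hP : Function.Involutive P)
    {w : Y} (hw : P w = w) : ∃ t, IsAltStop N P w t := by
  have hinj : Function.Injective (P ∘ N) := hP.injective.comp hN.injective
  have hex : ∃ t, P (N ((P ∘ N)^[t] w)) = N ((P ∘ N)^[t] w) := by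
    obtain ⟨r, hr, hper⟩ := Function.Injective.mem_periodicPts hinj w
    refine ⟨r - 1, ?_⟩
    have h1 : (P ∘ N)^[r - 1 + 1] w = w := by
      rw [Nat.sub_add_cancel hr]; exact hper
    rw [Function.iterate_succ_apply'] at h1
    simp only [Function.comp_apply] at h1
    have h2 : N ((P ∘ N)^[r - 1] w) = P w := by
      rw [← hP (N ((P ∘ N)^[r - 1] w))]
      exact congrArg P h1
    rw [h2, hw, hw]
  exact ⟨Nat.find hex, fun j hj => Nat.find_min hex hj, Nat.find_spec hex⟩

namespace IsAltStop

lemma ne_fixed (hP : Function.Involutive P) {w : Y} {t : ℕ} (h : IsAltStop N P w t) {j : ℕ}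
    (hj : 1 ≤ j) (hjt : j ≤ t) : P ((P ∘ N)^[j] w) ≠ (P ∘ N)^[j] w := by
  obtain ⟨i, rfl⟩ : ∃ i, j = i + 1 := ⟨j - 1, by omega⟩
  have h1 := h.1 i (by omega)
  rw [Function.iterate_succ_apply']
  simp only [Function.comp_apply]
  rw [hP]
  exact h1.symm

/-- After cancelling common iterates, the start of one path, a fixed point of P, would be a later
point of the other, and those are not fixed. -/
lemma eq_of_iterate_eq (hN : Function.Involutive N) (hP : Function.Involutive P) {w w' : Y}
    {t t' : ℕ} (hw : P w = w) (hw' : P w' = w') (h : IsAltStop N P w t)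
    (h' : IsAltStop N P w' t') {i j : ℕ} (hi : i ≤ t) (hj : j ≤ t')
    (hij : (P ∘ N)^[i] w = (P ∘ N)^[j] w') : w = w' ∧ i = j := by
  have hinj : Function.Injective (P ∘ N) := hP.injective.comp hN.injective
  have key : ∀ {w w' : Y} {t' : ℕ} (_ : P w = w) (_ : IsAltStop N P w' t') {i j : ℕ}
      (_ : i ≤ j) (_ : j ≤ t') (_ : (P ∘ N)^[i] w = (P ∘ N)^[j] w'), w = w' ∧ i = j := by
    intro w w' t' hw h' i j hle hj hij
    obtain ⟨e, rfl⟩ := Nat.exists_eq_add_of_le hle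
    rw [Function.iterate_add_apply] at hij
    have h1 := hinj.iterate i hij
    rcases Nat.eq_zero_or_pos e with rfl | he
    · exact ⟨h1, rfl⟩
    · have := h'.ne_fixed hP he (by omega)
      rw [← h1] at this
      exact absurd hw this
  rcases le_total i j with hle | hle
  · exact key hw h' hle hj hij
  · obtain ⟨h1, h2⟩ := key hw' h hle hi hij.symm
    exact ⟨h1.symm, h2.symm⟩

/-- A coincidence of the i-th point with the `N`-image of the j-th, i ≤ j, moves inwards to i + 1
and j - 1. At gap 0 it gives a fixed point of N, at gap 1 a later path point fixed by P. -/
lemma iterate_ne_apply (hN : Function.Involutive N) (hP : Function.Involutive P)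
    (hN1 : ∀ y, N y ≠ y) {w : Y} {t : ℕ} (h : IsAltStop N P w t) {i j : ℕ} (hi : i ≤ t)
    (hj : j ≤ t) : (P ∘ N)^[i] w ≠ N ((P ∘ N)^[j] w) := by
  have key : ∀ e i j : ℕ, j = i + e → j ≤ t → (P ∘ N)^[i] w ≠ N ((P ∘ N)^[j] w) := by
    intro e
    induction e using Nat.strong_induction_on with
    | _ e ih =>
      intro i j hij hj heq
      have h1 : P ((P ∘ N)^[i + 1] w) = (P ∘ N)^[j] w := by
        rw [Function.iterate_succ_apply']
        simp only [Function.comp_apply]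
        rw [hP, heq, hN]
      rcases e with _ | _ | e
      · simp only [add_zero] at hij
        subst hij
        exact hN1 _ heq.symm
      · subst hij
        simp only [zero_add] at h1 hj
        exact h.ne_fixed hP (by omega) hj h1
      · refine ih e (by omega) (i + 1) (j - 1) (by omega) (by omega) ?_
        obtain ⟨l, rfl⟩ : ∃ l, j = l + 1 := ⟨j - 1, by omega⟩
        rw [Nat.add_sub_cancel]
        rw [Function.iterate_succ_apply' _ l] at h1
        exact hP.injective h1
  rcases le_total i j with hle | hle
  · obtain ⟨e, he⟩ := Nat.exists_eq_add_of_le hle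
    exact key e i j he hj
  · obtain ⟨e, he⟩ := Nat.exists_eq_add_of_le hle
    intro heq
    exact key e j i he hi (by rw [heq, hN])

/-- Few alternating paths are long, since they are disjoint. -/
lemma card_mul_le (hN : Function.Involutive N) (hP : Function.Involutive P) (W Q : Finset Y)
    (t : Y → ℕ) (hW : ∀ w ∈ W, P w = w) (h : ∀ w ∈ W, IsAltStop N P w (t w))
    (hQ : ∀ y, P y ≠ y → y ∈ Q) {L : ℕ} (hL : ∀ w ∈ W, L ≤ t w) : #W * L ≤ #Q := by
  have : #(W ×ˢ Finset.Icc 1 L) ≤ #Q := by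
    refine Finset.card_le_card_of_injOn (fun x => (P ∘ N)^[x.2] x.1) ?_ ?_
    · rintro ⟨w, j⟩ hx
      simp only [coe_product, Set.mem_prod, mem_coe, Finset.mem_Icc] at hx
      exact hQ _ ((h w hx.1).ne_fixed hP hx.2.1 (hx.2.2.trans (hL w hx.1)))
    · rintro ⟨w, j⟩ hx ⟨w', j'⟩ hx' heq
      simp only [coe_product, Set.mem_prod, mem_coe, Finset.mem_Icc] at hx hx'
      obtain ⟨h1, h2⟩ := eq_of_iterate_eq hN hP (hW w hx.1) (hW w' hx'.1) (h w hx.1) (h w' hx'.1)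
        (hx.2.2.trans (hL w hx.1)) (hx'.2.2.trans (hL w' hx'.1)) heq
      exact Prod.ext h1 h2
  simpa using this

end IsAltStop

end AlternatingPaths

/-! ### Counting short walks of darts that contain a conflict. -/

section DartWalks

open scoped Classical
open Finset

variable {V κ : Type*}

/-- The end of the dart `g` other than `a`. -/
noncomputable def dartOther (π : κ → Equiv.Perm V) (g : κ × V) (a : V) : V :=
  if g.2 = a then π g.1 a else g.2

lemma DartJoins.other_eq {π : κ → Equiv.Perm V} {g : κ × V} {a b : V} (h : DartJoins π g a b)
    (hg : π g.1 g.2 ≠ g.2) : dartOther π g a = b := by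
  rcases h with ⟨h1, h2⟩ | ⟨h1, h2⟩
  · rw [dartOther, if_pos h1, h2]
  · rw [dartOther, if_neg, h1]
    rintro h3
    exact hg (by rw [h1, h2, ← h3, h1])

/-- The darts in `Ω` at the vertex `a`. -/
noncomputable def dartsAt (π : κ → Equiv.Perm V) (Ω : Finset (κ × V)) (a : V) : Finset (κ × V) :=
  Ω.filter fun g => g.2 = a ∨ π g.1 g.2 = a

/-- The walks of `r + 1` darts of `Ω` from `a` whose last colour is in `Q`, where the map `Mq` is
applied between any two consecutive darts. -/
noncomputable def dartWalks (π : κ → Equiv.Perm V) (Ω : Finset (κ × V)) (Mq : V → V)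
    (Q : Finset κ) : ℕ → V → Finset (List (κ × V))
  | 0, a => ((dartsAt π Ω a).filter fun g => g.1 ∈ Q).image fun g => [g]
  | r + 1, a => (dartsAt π Ω a).biUnion fun g =>
      (dartWalks π Ω Mq Q r (Mq (dartOther π g a))).image fun l => g :: l

variable {π : κ → Equiv.Perm V} {Ω : Finset (κ × V)} {Mq : V → V} {C Q : Finset κ}

/-- For every colour, the permutation has one dart leaving a and one entering it. -/
lemma card_dartsAt_filter_le (a : V) : #((dartsAt π Ω a).filter fun g => g.1 ∈ Q) ≤ 2 * #Q := by
  have h1 : (dartsAt π Ω a).filter (fun g => g.1 ∈ Q) ⊆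
      (Q.image fun c => (c, a)) ∪ Q.image fun c => (c, (π c).symm a) := by
    rintro ⟨c, v⟩ h
    simp only [dartsAt, mem_filter] at h
    simp only [mem_union, mem_image, Prod.mk.injEq]
    rcases h with ⟨⟨_, h | h⟩, hQ⟩
    · exact Or.inl ⟨c, hQ, rfl, h.symm⟩
    · exact Or.inr ⟨c, hQ, rfl, by rw [← h]; simp⟩
  have h2 := (card_le_card h1).trans (card_union_le _ _)
  have h3 := card_image_le (s := Q) (f := fun c => (c, a))
  have h4 := card_image_le (s := Q) (f := fun c => (c, (π c).symm a))
  omega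

lemma card_dartWalks_le (hΩ : ∀ g ∈ Ω, g.1 ∈ C) (r : ℕ) (a : V) :
    #(dartWalks π Ω Mq Q r a) ≤ (2 * #C) ^ r * (2 * #Q) := by
  induction r generalizing a with
  | zero =>
    rw [pow_zero, one_mul]
    exact card_image_le.trans (card_dartsAt_filter_le a)
  | succ r ih =>
    rw [dartWalks]
    have h1 : #(dartsAt π Ω a) ≤ 2 * #C := by
      rw [← Finset.filter_true_of_mem (s := dartsAt π Ω a) (p := fun g => g.1 ∈ C)]
      · exact card_dartsAt_filter_le a
      · intro g hg
        exact hΩ g (mem_filter.1 hg).1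
    refine (card_biUnion_le_card_mul _ _ _ fun g _ => card_image_le.trans (ih _)).trans ?_
    calc _ ≤ 2 * #C * ((2 * #C) ^ r * (2 * #Q)) := Nat.mul_le_mul_right _ h1
      _ = _ := by ring

lemma length_of_mem_dartWalks {r : ℕ} {a : V} {l : List (κ × V)}
    (hl : l ∈ dartWalks π Ω Mq Q r a) : l.length = r + 1 := by
  induction r generalizing a l with
  | zero =>
    simp only [dartWalks, mem_image] at hl
    obtain ⟨g, _, rfl⟩ := hl
    rfl
  | succ r ih =>
    simp only [dartWalks, mem_biUnion, mem_image] at hl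
    obtain ⟨g, _, l', hl', rfl⟩ := hl
    simp [ih hl']

lemma subset_of_mem_dartWalks {r : ℕ} {a : V} {l : List (κ × V)}
    (hl : l ∈ dartWalks π Ω Mq Q r a) : ∀ g ∈ l, g ∈ Ω := by
  induction r generalizing a l with
  | zero =>
    simp only [dartWalks, mem_image, mem_filter, dartsAt] at hl
    obtain ⟨g, hg, rfl⟩ := hl
    simpa using hg.1.1
  | succ r ih =>
    simp only [dartWalks, mem_biUnion, mem_image, mem_filter, dartsAt] at hl
    obtain ⟨g, hg, l', hl', rfl⟩ := hl
    intro x hx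
    rcases List.mem_cons.1 hx with rfl | hx
    · exact hg.1
    · exact ih hl' x hx

/-- The darts `g 0, …, g r` in `T` form a walk through `a 0, b 0, a 1 = Mq (b 0), b 1, …`. -/
structure IsDartWalk (π : κ → Equiv.Perm V) (T : Finset (κ × V)) (Mq : V → V) (r : ℕ)
    (g : ℕ → κ × V) (a b : ℕ → V) : Prop where
  mem : ∀ j ≤ r, g j ∈ T
  joins : ∀ j ≤ r, DartJoins π (g j) (a j) (b j)
  step : ∀ j < r, Mq (b j) = a (j + 1)
  inj : ∀ i ≤ r, ∀ j ≤ r, g i = g j → i = j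

lemma IsDartWalk.tail {T : Finset (κ × V)} {r : ℕ} {g : ℕ → κ × V} {a b : ℕ → V}
    (h : IsDartWalk π T Mq (r + 1) g a b) :
    IsDartWalk π T Mq r (fun j => g (j + 1)) (fun j => a (j + 1)) (fun j => b (j + 1)) where
  mem j hj := h.mem _ (by omega)
  joins j hj := h.joins _ (by omega)
  step j hj := h.step _ (by omega)
  inj i hi j hj hij := by have := h.inj _ (by omega) _ (by omega) hij; omega

lemma IsDartWalk.mem_dartWalks {r : ℕ} {g : ℕ → κ × V} {a b : ℕ → V}
    (hπ : ∀ g ∈ Ω, π g.1 g.2 ≠ g.2)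
    (h : IsDartWalk π Ω Mq r g a b) (hQ : (g r).1 ∈ Q) :
    (List.range (r + 1)).map g ∈ dartWalks π Ω Mq Q r (a 0) := by
  have hat : ∀ {r : ℕ} {g : ℕ → κ × V} {a b : ℕ → V} (_ : IsDartWalk π Ω Mq r g a b),
      g 0 ∈ dartsAt π Ω (a 0) := by
    intro r g a b h
    refine mem_filter.2 ⟨h.mem 0 (by omega), ?_⟩
    rcases h.joins 0 (by omega) with ⟨h1, h2⟩ | ⟨h1, h2⟩
    · exact Or.inl h1
    · exact Or.inr (by rw [h1, h2])
  induction r generalizing g a b with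
  | zero =>
    simp only [dartWalks, mem_image, mem_filter]
    exact ⟨g 0, ⟨hat h, hQ⟩, rfl⟩
  | succ r ih =>
    simp only [dartWalks, mem_biUnion, mem_image]
    refine ⟨g 0, hat h, (List.range (r + 1)).map (fun j => g (j + 1)), ?_, ?_⟩
    · have h0 := (h.joins 0 (by omega)).other_eq (hπ _ (h.mem 0 (by omega)))
      rw [h0, h.step 0 (by omega)]
      exact ih h.tail hQ
    · conv_rhs => rw [List.range_succ_eq_map]
      simp [Function.comp_def]

lemma nodup_map_range {r : ℕ} {g : ℕ → κ × V} (hg : ∀ i ≤ r, ∀ j ≤ r, g i = g j → i = j) :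
    ((List.range (r + 1)).map g).Nodup := by
  refine List.Nodup.map_on ?_ List.nodup_range
  intro x hx y hy hxy
  rw [List.mem_range] at hx hy
  exact hg x (by omega) y (by omega) hxy

lemma sum_biUnion_le_of_nonneg {J A : Type*} [DecidableEq A] (s : Finset J) (t : J → Finset A) {f : A → ℝ}
    (hf : ∀ a, 0 ≤ f a) : ∑ a ∈ s.biUnion t, f a ≤ ∑ j ∈ s, ∑ a ∈ t j, f a := by
  induction s using Finset.induction_on with
  | empty => simp
  | insert j s hj ih =>
    rw [biUnion_insert, sum_insert hj]
    refine le_trans ?_ (add_le_add_right ih _)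
    rw [← Finset.sum_union_inter]
    exact le_add_of_nonneg_right (Finset.sum_nonneg fun l _ => hf l)

/-- The expected number of short walks in a sparse random set of darts that contain a conflict,
according to the family `h` of sets of vertices and colours, is small. -/
theorem exists_conflict_family (hΩ : ∀ g ∈ Ω, g.1 ∈ C) (hπ : ∀ g ∈ Ω, π g.1 g.2 ≠ g.2)
    (h : κ → Finset (V ⊕ κ)) {ℓ s : ℕ} (hcard : ∀ c ∈ C, #(h c) ≤ ℓ)
    (hcong : ∀ z, #(C.filter fun c => z ∈ h c) ≤ s) (L : ℕ) {p τ : ℝ} (hp : 0 < p)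
    (hτ : 1 ≤ τ) (hCp : #C * p ≤ τ) (hΩp : #Ω * p ≤ 2 * τ * #C) :
    ∃ 𝓑 : Finset (Finset (κ × V)), (∀ F ∈ 𝓑, F.Nonempty ∧ F ⊆ Ω) ∧
      ∑ F ∈ 𝓑, p ^ #F ≤ (L + 1) * (2 * τ) ^ L * (12 * ℓ * s * #C * p * τ) ∧
      ∀ T ⊆ Ω, (∀ F ∈ 𝓑, ¬ F ⊆ T) → ∀ r ≤ L, ∀ g a b,
        (IsDartWalk π T Mq r g a b → ∀ z, a 0 = z ∨ a 0 = Mq z → Sum.inl z ∉ h (g r).1) ∧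
        (IsDartWalk π T Mq (r + 1) g a b → Disjoint (h (g 0).1) (h (g (r + 1)).1)) := by
  set Z : Finset V := C.biUnion fun c => (h c).toLeft with hZ
  let Qv : V → Finset κ := fun z => C.filter fun c => Sum.inl z ∈ h c
  let Qc : κ → Finset κ := fun c => C.filter fun d => ¬ Disjoint (h c) (h d)
  -- Two kinds of conflict: the last colour has z in its home, where the walk starts at z or `Mq z`
  -- (`A1`); or the homes of the first and the last colour meet (`A2`).
  let A1 : ℕ → Finset (List (κ × V)) := fun r => Z.biUnion fun z =>
    ({z, Mq z} : Finset V).biUnion fun a => dartWalks π Ω Mq (Qv z) r a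
  let A2 : ℕ → Finset (List (κ × V)) := fun r => Ω.biUnion fun g =>
    ({g.2, π g.1 g.2} : Finset V).biUnion fun b =>
      (dartWalks π Ω Mq (Qc g.1) r (Mq b)).image fun l => g :: l
  let 𝓛 : Finset (List (κ × V)) := (range (L + 1)).biUnion fun r => A1 r ∪ A2 r
  have hZcard : #Z ≤ #C * ℓ := card_biUnion_le_card_mul _ _ _ fun c hc =>
    (Finset.card_toLeft_le).trans (hcard c hc)
  have hQc : ∀ c ∈ C, #(Qc c) ≤ ℓ * s := by
    intro c hc
    have : Qc c ⊆ (h c).biUnion fun z => C.filter fun d => z ∈ h d := by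
      intro d hd
      obtain ⟨hdC, hd⟩ := mem_filter.1 hd
      obtain ⟨z, hz, hz'⟩ := Finset.not_disjoint_iff.1 hd
      exact mem_biUnion.2 ⟨z, hz, mem_filter.2 ⟨hdC, hz'⟩⟩
    refine (card_le_card this).trans ((card_biUnion_le_card_mul _ _ s fun z _ => hcong z).trans ?_)
    exact Nat.mul_le_mul_right _ (hcard c hc)
  have hA1len : ∀ r, ∀ l ∈ A1 r, l.length = r + 1 := by
    intro r l hl
    simp only [A1, mem_biUnion] at hl
    obtain ⟨z, _, a, _, hl⟩ := hl
    exact length_of_mem_dartWalks hl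
  have hA2len : ∀ r, ∀ l ∈ A2 r, l.length = r + 2 := by
    intro r l hl
    simp only [A2, mem_biUnion, mem_image] at hl
    obtain ⟨g, _, b, _, l', hl, rfl⟩ := hl
    simp [length_of_mem_dartWalks hl]
  have hA1card : ∀ r, #(A1 r) ≤ #C * ℓ * (2 * ((2 * #C) ^ r * (2 * s))) := by
    intro r
    refine (card_biUnion_le_card_mul _ _ (2 * ((2 * #C) ^ r * (2 * s))) fun z _ => ?_).trans
      (Nat.mul_le_mul_right _ hZcard)
    refine (card_biUnion_le_card_mul _ _ ((2 * #C) ^ r * (2 * s)) fun a _ => ?_).trans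
      (Nat.mul_le_mul_right _ Finset.card_le_two)
    refine (card_dartWalks_le hΩ r a).trans ?_
    have := hcong (Sum.inl z)
    gcongr
  have hA2card : ∀ r, #(A2 r) ≤ #Ω * (2 * ((2 * #C) ^ r * (2 * (ℓ * s)))) := by
    intro r
    refine card_biUnion_le_card_mul _ _ (2 * ((2 * #C) ^ r * (2 * (ℓ * s)))) fun g hg => ?_
    refine (card_biUnion_le_card_mul _ _ ((2 * #C) ^ r * (2 * (ℓ * s))) fun a _ => ?_).trans
      (Nat.mul_le_mul_right _ Finset.card_le_two)
    refine card_image_le.trans ((card_dartWalks_le hΩ r _).trans ?_)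
    have := hQc g.1 (hΩ g hg)
    gcongr
  have h𝓛sub : ∀ l ∈ 𝓛, l ≠ [] ∧ ∀ g ∈ l, g ∈ Ω := by
    intro l hl
    simp only [𝓛, A1, A2, mem_biUnion, mem_union, mem_image] at hl
    obtain ⟨r, _, ⟨z, _, a, _, hl⟩ | ⟨g, hg, b, _, l', hl, rfl⟩⟩ := hl
    · refine ⟨?_, subset_of_mem_dartWalks hl⟩
      rintro rfl
      simpa using length_of_mem_dartWalks hl
    · refine ⟨by simp, ?_⟩
      intro x hx
      rcases List.mem_cons.1 hx with rfl | hx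
      · exact hg
      · exact subset_of_mem_dartWalks hl x hx
  -- Restricting to walks without repeated darts makes the weight of the underlying set equal to p
  -- to the length.
  refine ⟨(𝓛.filter fun l => l.Nodup).image List.toFinset, ?_, ?_, ?_⟩
  · intro F hF
    simp only [mem_image, mem_filter] at hF
    obtain ⟨l, ⟨hl, _⟩, rfl⟩ := hF
    refine ⟨List.toFinset_nonempty_iff l |>.2 (h𝓛sub l hl).1, fun g hg => ?_⟩
    exact (h𝓛sub l hl).2 g (List.mem_toFinset.1 hg)
  · have e1 : ∑ F ∈ (𝓛.filter fun l => l.Nodup).image List.toFinset, p ^ #F ≤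
        ∑ l ∈ 𝓛, p ^ l.length := by
      refine (Finset.sum_image_le_of_nonneg (g := List.toFinset)
        (f := fun F => p ^ #F) fun l _ => by positivity).trans ?_
      refine (Finset.sum_le_sum (g := fun l => p ^ l.length) fun l hl => ?_).trans
        (Finset.sum_le_sum_of_subset_of_nonneg (filter_subset _ _) fun l _ _ => by positivity)
      rw [List.toFinset_card_of_nodup (mem_filter.1 hl).2]
    have e2 : ∑ l ∈ 𝓛, p ^ l.length ≤ ∑ r ∈ range (L + 1),
        (∑ l ∈ A1 r, p ^ l.length + ∑ l ∈ A2 r, p ^ l.length) := by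
      refine (sum_biUnion_le_of_nonneg (range (L + 1)) (fun r => A1 r ∪ A2 r) (f := fun l : List (κ × V) => p ^ l.length)
        (fun l => by positivity)).trans ?_
      refine Finset.sum_le_sum fun r _ => ?_
      rw [← Finset.sum_union_inter]
      exact le_add_of_nonneg_right (Finset.sum_nonneg fun l _ => by positivity)
    have e3 : ∀ r ∈ range (L + 1), (∑ l ∈ A1 r, p ^ l.length + ∑ l ∈ A2 r, p ^ l.length) ≤
        (2 * τ) ^ L * (12 * ℓ * s * #C * p * τ) := by
      intro r hr
      have hrL : r ≤ L := by simpa [Nat.lt_succ_iff] using hr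
      rw [Finset.sum_congr (s₁ := A1 r) rfl (g := fun _ => p ^ (r + 1))
          fun l hl => by rw [hA1len r l hl],
        Finset.sum_congr (s₁ := A2 r) rfl (g := fun _ => p ^ (r + 2)) fun l hl => by rw [hA2len r l hl],
        Finset.sum_const, Finset.sum_const, nsmul_eq_mul, nsmul_eq_mul]
      have f1 : (#(A1 r) : ℝ) ≤ #C * ℓ * (2 * ((2 * #C) ^ r * (2 * s))) := by
        exact_mod_cast hA1card r
      have f2 : (#(A2 r) : ℝ) ≤ #Ω * (2 * ((2 * #C) ^ r * (2 * (ℓ * s)))) := by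
        exact_mod_cast hA2card r
      have f3 : (2 * (#C * p)) ^ r ≤ (2 * τ) ^ L := by
        calc (2 * (#C * p)) ^ r ≤ (2 * τ) ^ r := by gcongr
          _ ≤ (2 * τ) ^ L := pow_le_pow_right₀ (by linarith) hrL
      -- An unrestricted step has at most 2|C| choices and survives with probability p, a factor of
      -- at most 2τ. The gain is at the last dart, whose colour has only s or ℓs choices.
      calc _ ≤ (#C * ℓ * (2 * ((2 * #C) ^ r * (2 * s)))) * p ^ (r + 1) +
            (#Ω * (2 * ((2 * #C) ^ r * (2 * (ℓ * s))))) * p ^ (r + 2) := by gcongr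
        _ = (2 * (#C * p)) ^ r * (4 * ℓ * s * p * (#C + #Ω * p)) := by
          rw [mul_pow, mul_pow, mul_pow]; ring
        _ ≤ (2 * τ) ^ L * (4 * ℓ * s * p * (τ * #C + 2 * τ * #C)) := by
          gcongr
          nlinarith [Nat.cast_nonneg (α := ℝ) #C]
        _ = _ := by ring
    refine e1.trans (e2.trans ((Finset.sum_le_sum e3).trans ?_))
    rw [Finset.sum_const, card_range, nsmul_eq_mul]
    push_cast
    exact (mul_assoc _ _ _).ge
  · intro T hT hTB r hr g a b
    have hno : ∀ l ∈ 𝓛, l.Nodup → ¬ ∀ x ∈ l, x ∈ T := by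
      intro l hl hnd hlT
      refine hTB l.toFinset (mem_image_of_mem _ (mem_filter.2 ⟨hl, hnd⟩)) ?_
      intro x hx
      exact hlT x (List.mem_toFinset.1 hx)
    have hmono : ∀ {r g a b}, IsDartWalk π T Mq r g a b → IsDartWalk π Ω Mq r g a b :=
      fun h => ⟨fun j hj => hT (h.mem j hj), h.joins, h.step, h.inj⟩
    constructor
    · intro hw z hz hzh
      refine hno _ ?_ (nodup_map_range hw.inj) ?_
      · refine mem_biUnion.2 ⟨r, mem_range.2 (by omega), mem_union_left _ ?_⟩
        have hc : (g r).1 ∈ C := hΩ _ (hT (hw.mem r le_rfl))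
        refine mem_biUnion.2 ⟨z, ?_, mem_biUnion.2 ⟨a 0, ?_, ?_⟩⟩
        · exact mem_biUnion.2 ⟨(g r).1, hc, Finset.mem_toLeft.2 hzh⟩
        · simpa using hz
        · exact (hmono hw).mem_dartWalks hπ (mem_filter.2 ⟨hc, hzh⟩)
      · intro x hx
        obtain ⟨j, hj, rfl⟩ := List.mem_map.1 hx
        exact hw.mem j (by have := List.mem_range.1 hj; omega)
    · intro hw
      by_contra hdis
      refine hno _ ?_ (nodup_map_range hw.inj) ?_
      · refine mem_biUnion.2 ⟨r, mem_range.2 (by omega), mem_union_right _ ?_⟩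
        refine mem_biUnion.2 ⟨g 0, hT (hw.mem 0 (by omega)), mem_biUnion.2 ⟨b 0, ?_, ?_⟩⟩
        · rcases hw.joins 0 (by omega) with ⟨h1, h2⟩ | ⟨h1, h2⟩
          · simp [← h2, h1]
          · simp [h1]
        · refine mem_image.2 ⟨(List.range (r + 1)).map (fun j => g (j + 1)), ?_, ?_⟩
          · rw [hw.step 0 (by omega)]
            exact (hmono hw).tail.mem_dartWalks hπ
              (mem_filter.2 ⟨hΩ _ (hT (hw.mem (r + 1) le_rfl)), hdis⟩)
          · conv_rhs => rw [List.range_succ_eq_map]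
            simp [Function.comp_def]
      · intro x hx
        obtain ⟨j, hj, rfl⟩ := List.mem_map.1 hx
        exact hw.mem j (by have := List.mem_range.1 hj; omega)

end DartWalks

/-! ### Simultaneous switches of a rainbow matching. -/

section Switches

open scoped Classical
open Finset

variable {V κ : Type*}

/-- The two ends and the colour of the edge `e = (c, u, v)`. -/
noncomputable def edgeItems (e : κ × V × V) : Finset (V ⊕ κ) :=
  {Sum.inl e.2.1, Sum.inl e.2.2, Sum.inr e.1}

lemma mem_edgeItems {e : κ × V × V} {z : V ⊕ κ} :
    z ∈ edgeItems e ↔ z = Sum.inl e.2.1 ∨ z = Sum.inl e.2.2 ∨ z = Sum.inr e.1 := by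
  simp [edgeItems]

lemma inl_mem_edgeItems {e : κ × V × V} {v : V} :
    Sum.inl v ∈ edgeItems e ↔ v = e.2.1 ∨ v = e.2.2 := by
  simp [mem_edgeItems]

lemma inr_mem_edgeItems {e : κ × V × V} {c : κ} : Sum.inr c ∈ edgeItems e ↔ c = e.1 := by
  simp [mem_edgeItems]

lemma card_edgeItems_le (e : κ × V × V) : #(edgeItems e) ≤ 3 := Finset.card_le_three

/-- A set of coloured edges is a rainbow matching for the family `E` of adjacency relations. -/
structure IsRainbowFinset (E : κ → V → V → Prop) (X : Finset (κ × V × V)) : Prop where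
  edge : ∀ e ∈ X, E e.1 e.2.1 e.2.2
  disj : ∀ e ∈ X, ∀ f ∈ X, e ≠ f → Disjoint (edgeItems e) (edgeItems f)

lemma IsRainbowFinset.eq_of_mem {E : κ → V → V → Prop} {X : Finset (κ × V × V)}
    (hX : IsRainbowFinset E X) {e f : κ × V × V} (he : e ∈ X) (hf : f ∈ X) {z : V ⊕ κ}
    (hze : z ∈ edgeItems e) (hzf : z ∈ edgeItems f) : e = f := by
  by_contra hne
  exact Finset.disjoint_left.1 (hX.disj e he f hf hne) hze hzf

lemma IsRainbowFinset.injOn_colour {E : κ → V → V → Prop} {X : Finset (κ × V × V)}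
    (hX : IsRainbowFinset E X) : Set.InjOn Prod.fst (X : Set (κ × V × V)) := by
  intro e he f hf hef
  exact hX.eq_of_mem he hf (z := Sum.inr e.1) (inr_mem_edgeItems.2 rfl) (inr_mem_edgeItems.2 hef)

/-- The matching `sw` has at least as many edges as `M` and does not use the colour `c`;
it differs from `M` only within the set `h` of vertices and colours. -/
structure IsSwitch (E : κ → V → V → Prop) (M : Finset (κ × V × V)) (c : κ) (h : Finset (V ⊕ κ))
    (sw : Finset (κ × V × V)) : Prop where
  rainbow : IsRainbowFinset E sw
  card_le : #M ≤ #sw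
  free : ∀ e ∈ sw, e.1 ≠ c
  removed : ∀ e ∈ M, e ∉ sw → edgeItems e ⊆ h
  added : ∀ e ∈ sw, e ∉ M → edgeItems e ⊆ h
  self : Sum.inr c ∈ h

/-- Disjoint switches can be carried out simultaneously, and then the colours that they free can
be used for a set `D` of new edges replacing the edges in `A`. -/
theorem exists_combined_switch {E : κ → V → V → Prop} {M : Finset (κ × V × V)}
    (hM : IsRainbowFinset E M) {Q : Finset κ} {h : κ → Finset (V ⊕ κ)}
    {sw : κ → Finset (κ × V × V)} (hsw : ∀ c ∈ Q, IsSwitch E M c (h c) (sw c))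
    (hdis : ∀ c ∈ Q, ∀ d ∈ Q, c ≠ d → Disjoint (h c) (h d))
    {A D : Finset (κ × V × V)} (hD : IsRainbowFinset E D) (hDQ : ∀ e ∈ D, e.1 ∈ Q)
    (hDA : ∀ e ∈ D, ∀ v, Sum.inl v ∈ edgeItems e → ∀ f ∈ M, Sum.inl v ∈ edgeItems f → f ∈ A)
    (hDh : ∀ e ∈ D, ∀ v, Sum.inl v ∈ edgeItems e → ∀ c ∈ Q, Sum.inl v ∉ h c) :
    ∃ M', IsRainbowFinset E M' ∧ #M + #D ≤ #M' + #A ∧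
      (∀ e ∈ M, e ∉ M' → e ∈ A ∨ ∃ c ∈ Q, edgeItems e ⊆ h c) ∧
      (∀ e ∈ M', (e ∈ M ∧ e ∉ A) ∨ e ∈ D ∨ ∃ c ∈ Q, e ∈ sw c ∧ e ∉ M) := by
  -- `R` collects the edges that the switches remove and `S` those that they add. No switch shrinks
  -- `M`, and the additions of different switches are disjoint, so |R| ≤ |S|.
  set R := Q.biUnion fun c => M \ sw c with hR
  set S := Q.biUnion fun c => sw c \ M with hS
  have hMR : ∀ e ∈ M \ (A ∪ R), e ∈ M ∧ e ∉ A ∧ ∀ c ∈ Q, e ∈ sw c := by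
    intro e he
    simp only [mem_sdiff, mem_union, not_or, hR, mem_biUnion, not_exists, not_and, not_not] at he
    exact ⟨he.1, he.2.1, fun c hc => he.2.2 c hc he.1⟩
  have hSm : ∀ e ∈ S, ∃ c ∈ Q, e ∈ sw c ∧ e ∉ M := by
    intro e he
    simpa only [hS, mem_biUnion, mem_sdiff] using he
  have hMD : ∀ e ∈ M \ (A ∪ R), ∀ f ∈ D, Disjoint (edgeItems e) (edgeItems f) := by
    intro e he f hf
    obtain ⟨h1, h2, h3⟩ := hMR e he
    rw [Finset.disjoint_left]
    rintro (v | c) hze hzf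
    · exact h2 (hDA f hf v hzf e h1 hze)
    · rw [inr_mem_edgeItems] at hze hzf
      exact (hsw _ (hDQ f hf)).free e (h3 _ (hDQ f hf)) (hze.symm.trans hzf)
  have hDS : ∀ e ∈ D, ∀ f ∈ S, Disjoint (edgeItems e) (edgeItems f) := by
    intro e he f hf
    obtain ⟨c, hc, h1, h2⟩ := hSm f hf
    rw [Finset.disjoint_left]
    rintro (v | d) hze hzf
    · exact hDh e he v hze c hc ((hsw c hc).added f h1 h2 hzf)
    · have h3 := (hsw c hc).added f h1 h2 hzf
      rw [inr_mem_edgeItems] at hze hzf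
      by_cases hdc : d = c
      · exact (hsw c hc).free f h1 (hzf.symm.trans hdc)
      -- A home contains its own colour, so disjoint homes stop the switch of c from reintroducing
      -- another colour d of Q.
      · have hdQ : d ∈ Q := hze ▸ hDQ e he
        exact Finset.disjoint_left.1 (hdis d hdQ c hc hdc) (hsw d hdQ).self h3
  have hMS : ∀ e ∈ M \ (A ∪ R), ∀ f ∈ S, Disjoint (edgeItems e) (edgeItems f) := by
    intro e he f hf
    obtain ⟨c, hc, h1, h2⟩ := hSm f hf
    obtain ⟨h3, _, h4⟩ := hMR e he
    exact (hsw c hc).rainbow.disj e (h4 c hc) f h1 (by rintro rfl; exact h2 h3)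
  have hSS : ∀ e ∈ S, ∀ f ∈ S, e ≠ f → Disjoint (edgeItems e) (edgeItems f) := by
    intro e he f hf hef
    obtain ⟨c, hc, h1, h2⟩ := hSm e he
    obtain ⟨d, hd, h3, h4⟩ := hSm f hf
    by_cases hcd : c = d
    · subst hcd
      exact (hsw c hc).rainbow.disj e h1 f h3 hef
    · exact (hdis c hc d hd hcd).mono ((hsw c hc).added e h1 h2) ((hsw d hd).added f h3 h4)
  have hne : ∀ e f : κ × V × V, Disjoint (edgeItems e) (edgeItems f) → e ≠ f := by
    rintro e f hdf rfl
    exact Finset.disjoint_left.1 hdf (inr_mem_edgeItems.2 rfl) (inr_mem_edgeItems.2 rfl)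
  refine ⟨(M \ (A ∪ R)) ∪ (D ∪ S), ⟨?_, ?_⟩, ?_, ?_, ?_⟩
  · intro e he
    rcases mem_union.1 he with he | he
    · exact hM.edge e (hMR e he).1
    rcases mem_union.1 he with he | he
    · exact hD.edge e he
    · obtain ⟨c, hc, h1, h2⟩ := hSm e he
      exact (hsw c hc).rainbow.edge e h1
  · intro e he f hf hef
    simp only [mem_union] at he hf
    rcases he with he | he | he <;> rcases hf with hf | hf | hf
    · exact hM.disj e (hMR e he).1 f (hMR f hf).1 hef
    · exact hMD e he f hf
    · exact hMS e he f hf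
    · exact (hMD f hf e he).symm
    · exact hD.disj e he f hf hef
    · exact hDS e he f hf
    · exact (hMS f hf e he).symm
    · exact (hDS f hf e he).symm
    · exact hSS e he f hf hef
  · have c1 : #S = ∑ c ∈ Q, #(sw c \ M) := by
      rw [hS, card_biUnion]
      intro c hc d hd hcd
      refine Finset.disjoint_left.2 fun e he he' => ?_
      obtain ⟨h1, h2⟩ := mem_sdiff.1 he
      obtain ⟨h3, h4⟩ := mem_sdiff.1 he'
      exact hne e e ((hdis c hc d hd hcd).mono ((hsw c hc).added e h1 h2)
        ((hsw d hd).added e h3 h4)) rfl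
    have c2 : #R ≤ #S := by
      rw [c1]
      refine card_biUnion_le.trans (Finset.sum_le_sum fun c hc => ?_)
      have h1 := (hsw c hc).card_le
      have h2 := card_sdiff_add_card_inter M (sw c)
      have h3 := card_sdiff_add_card_inter (sw c) M
      rw [inter_comm] at h3
      omega
    have c3 : #((M \ (A ∪ R)) ∪ (D ∪ S)) = #(M \ (A ∪ R)) + (#D + #S) := by
      rw [card_union_of_disjoint, card_union_of_disjoint]
      · rw [Finset.disjoint_left]
        intro e he he'
        exact hne e e (hDS e he e he') rfl
      · rw [Finset.disjoint_left]
        intro e he he'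
        rcases mem_union.1 he' with he' | he'
        · exact hne e e (hMD e he e he') rfl
        · exact hne e e (hMS e he e he') rfl
    have c4 := Finset.le_card_sdiff (A ∪ R) M
    have c5 := card_union_le A R
    omega
  · intro e he he'
    simp only [mem_union, not_or, mem_sdiff, not_and, not_not] at he'
    by_cases h0 : e ∈ A
    · exact Or.inl h0
    · right
      have h1 := he'.1 he h0
      simp only [hR, mem_biUnion, mem_sdiff] at h1
      obtain ⟨c, hc, h1, h2⟩ := h1
      exact ⟨c, hc, (hsw c hc).removed e h1 h2⟩
  · intro e he
    simp only [mem_union] at he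
    rcases he with he | he | he
    · exact Or.inl ⟨(hMR e he).1, (hMR e he).2.1⟩
    · exact Or.inr (Or.inl he)
    · obtain ⟨c, hc, h1, h2⟩ := hSm e he
      exact Or.inr (Or.inr ⟨c, hc, h1, h2⟩)

end Switches

/-! ### Switching along a single alternating path. -/

section PathSwitch

open scoped Classical
open Finset

variable {V κ : Type*}

/-- The partner of `v` in the matching `M`, or `v` itself if it is not covered. -/
noncomputable def partner (M : Finset (κ × V × V)) (v : V) : V :=
  if h : ∃ e ∈ M, Sum.inl v ∈ edgeItems e then
    if h.choose.2.1 = v then h.choose.2.2 else h.choose.2.1 else v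

section Partner

variable {E : κ → V → V → Prop} {M : Finset (κ × V × V)}

lemma partner_eq_snd (hM : IsRainbowFinset E M) {e : κ × V × V} (he : e ∈ M) :
    partner M e.2.1 = e.2.2 := by
  have h : ∃ f ∈ M, Sum.inl e.2.1 ∈ edgeItems f := ⟨e, he, inl_mem_edgeItems.2 (Or.inl rfl)⟩
  have h1 : h.choose = e := hM.eq_of_mem h.choose_spec.1 he h.choose_spec.2
    (inl_mem_edgeItems.2 (Or.inl rfl))
  rw [partner, dif_pos h, h1, if_pos rfl]

lemma partner_eq_fst (hM : IsRainbowFinset E M) (hE : ∀ c v, ¬ E c v v) {e : κ × V × V}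
    (he : e ∈ M) : partner M e.2.2 = e.2.1 := by
  have h : ∃ f ∈ M, Sum.inl e.2.2 ∈ edgeItems f := ⟨e, he, inl_mem_edgeItems.2 (Or.inr rfl)⟩
  have h1 : h.choose = e := hM.eq_of_mem h.choose_spec.1 he h.choose_spec.2
    (inl_mem_edgeItems.2 (Or.inr rfl))
  rw [partner, dif_pos h, h1, if_neg]
  intro h2
  have := hM.edge e he
  rw [h2] at this
  exact hE _ _ this

lemma partner_of_not_covered {v : V} (h : ∀ e ∈ M, Sum.inl v ∉ edgeItems e) :
    partner M v = v := by
  rw [partner, dif_neg]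
  rintro ⟨e, he, hv⟩
  exact h e he hv

lemma partner_mem (hM : IsRainbowFinset E M) (hE : ∀ c v, ¬ E c v v) {e : κ × V × V}
    (he : e ∈ M) {v : V} (hv : Sum.inl v ∈ edgeItems e) :
    Sum.inl (partner M v) ∈ edgeItems e ∧ partner M v ≠ v := by
  have hne : e.2.1 ≠ e.2.2 := fun h => by
    have := hM.edge e he
    rw [h] at this
    exact hE _ _ this
  rcases inl_mem_edgeItems.1 hv with rfl | rfl
  · rw [partner_eq_snd hM he]
    exact ⟨inl_mem_edgeItems.2 (Or.inr rfl), hne.symm⟩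
  · rw [partner_eq_fst hM hE he]
    exact ⟨inl_mem_edgeItems.2 (Or.inl rfl), hne⟩

lemma partner_involutive (hM : IsRainbowFinset E M) (hE : ∀ c v, ¬ E c v v) :
    Function.Involutive (partner M) := by
  intro v
  by_cases h : ∃ e ∈ M, Sum.inl v ∈ edgeItems e
  · obtain ⟨e, he, hv⟩ := h
    rcases inl_mem_edgeItems.1 hv with rfl | rfl
    · rw [partner_eq_snd hM he, partner_eq_fst hM hE he]
    · rw [partner_eq_fst hM hE he, partner_eq_snd hM he]
  · push Not at h
    rw [partner_of_not_covered h, partner_of_not_covered h]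

end Partner

/-- A path that starts in the vertex `a 0`, which is not covered by `M`, and whose edges alternate
between darts of `T` and edges of `M` avoiding `Out`, until it reaches a vertex `b t` that is in
`Out` or not covered. -/
structure IsAltPath (π : κ → Equiv.Perm V) (T : Finset (κ × V)) (M : Finset (κ × V × V))
    (Out : Finset V) (t : ℕ) (g : ℕ → κ × V) (a b : ℕ → V) : Prop where
  mem : ∀ j ≤ t, g j ∈ T
  joins : ∀ j ≤ t, DartJoins π (g j) (a j) (b j)
  step : ∀ j < t, partner M (b j) = a (j + 1)
  a_inj : ∀ i ≤ t, ∀ j ≤ t, a i = a j → i = j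
  b_inj : ∀ i ≤ t, ∀ j ≤ t, b i = b j → i = j
  ne : ∀ i ≤ t, ∀ j ≤ t, a i ≠ b j
  start : partner M (a 0) = a 0
  last : b t ∈ Out ∨ partner M (b t) = b t

namespace IsAltPath

variable {π : κ → Equiv.Perm V} {T : Finset (κ × V)} {M : Finset (κ × V × V)}
  {Out : Finset V} {t : ℕ} {g : ℕ → κ × V} {a b : ℕ → V}

/-- A dart determines its tail, and all the a's and b's of the path are distinct. -/
lemma g_inj (hp : IsAltPath π T M Out t g a b) : ∀ i ≤ t, ∀ j ≤ t, g i = g j → i = j := by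
  intro i hi j hj hij
  have h1 := hp.joins i hi
  have h2 := hp.joins j hj
  rw [← hij] at h2
  rcases h1 with ⟨h1, h1'⟩ | ⟨h1, h1'⟩ <;> rcases h2 with ⟨h2, h2'⟩ | ⟨h2, h2'⟩
  · exact hp.a_inj i hi j hj (h1.symm.trans h2)
  · exact absurd (h1.symm.trans h2) (hp.ne i hi j hj)
  · exact absurd (h2.symm.trans h1) (hp.ne j hj i hi)
  · exact hp.b_inj i hi j hj (h1.symm.trans h2)

lemma walk (hp : IsAltPath π T M Out t g a b) {i r : ℕ} (h : i + r ≤ t) :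
    IsDartWalk π T (partner M) r (fun l => g (i + l)) (fun l => a (i + l))
      (fun l => b (i + l)) where
  mem l hl := hp.mem _ (by omega)
  joins l hl := hp.joins _ (by omega)
  step l hl := hp.step _ (by omega)
  inj l hl l' hl' hll := by have := hp.g_inj _ (by omega) _ (by omega) hll; omega

/-- Read backwards, the path gives walks from a vertex to earlier darts, so one conflict condition
covers both directions. -/
lemma reverse_walk (hp : IsAltPath π T M Out t g a b)
    (hinv : Function.Involutive (partner M)) {j r : ℕ} (hj : j ≤ t) (h : r ≤ j) :
    IsDartWalk π T (partner M) r (fun l => g (j - l)) (fun l => b (j - l))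
      (fun l => a (j - l)) where
  mem l hl := hp.mem _ (by omega)
  joins l hl := (hp.joins _ (by omega)).symm
  step l hl := by
    have h1 := hp.step (j - (l + 1)) (by omega)
    rw [show j - (l + 1) + 1 = j - l by omega] at h1
    rw [← h1, hinv]
  inj l hl l' hl' hll := by have := hp.g_inj _ (by omega) _ (by omega) hll; omega

/-- The set of vertices and colours that are affected if the path is used. -/
noncomputable def home (M : Finset (κ × V × V)) (h : κ → Finset (V ⊕ κ)) (t : ℕ)
    (g : ℕ → κ × V) (a b : ℕ → V) : Finset (V ⊕ κ) :=
  (range (t + 1)).biUnion fun j =>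
    ((M.filter fun e => Sum.inl (b j) ∈ edgeItems e).biUnion edgeItems ∪
      {Sum.inl (a j), Sum.inl (b j)}) ∪ h (g j).1

variable {E : κ → V → V → Prop} {C : Finset κ} {h : κ → Finset (V ⊕ κ)}
  {sw : κ → Finset (κ × V × V)} {L : ℕ}

lemma card_filter_mem_le_one (hM : IsRainbowFinset E M) (z : V ⊕ κ) :
    #(M.filter fun e => z ∈ edgeItems e) ≤ 1 := by
  rw [Finset.card_le_one]
  intro e he f hf
  exact hM.eq_of_mem (mem_filter.1 he).1 (mem_filter.1 hf).1 (mem_filter.1 he).2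
    (mem_filter.1 hf).2

lemma card_home_le (hM : IsRainbowFinset E M) {ℓ : ℕ} (hℓ : ∀ j ≤ t, #(h (g j).1) ≤ ℓ) :
    #(home M h t g a b) ≤ (t + 1) * (5 + ℓ) := by
  refine (card_biUnion_le_card_mul _ _ (5 + ℓ) fun j hj => ?_).trans (by rw [card_range])
  have h1 := card_biUnion_le_card_mul (M.filter fun e => Sum.inl (b j) ∈ edgeItems e) edgeItems 3
    fun e _ => card_edgeItems_le e
  have h2 := card_filter_mem_le_one hM (Sum.inl (b j))
  have h3 : #({Sum.inl (a j), Sum.inl (b j)} : Finset (V ⊕ κ)) ≤ 2 := Finset.card_le_two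
  have h4 := hℓ j (by have := mem_range.1 hj; omega)
  have h5 := card_union_le ((M.filter fun e => Sum.inl (b j) ∈ edgeItems e).biUnion edgeItems ∪
      {Sum.inl (a j), Sum.inl (b j)}) (h (g j).1)
  have h6 := card_union_le ((M.filter fun e => Sum.inl (b j) ∈ edgeItems e).biUnion edgeItems)
      {Sum.inl (a j), Sum.inl (b j)}
  omega

/-- A conflict-free short alternating path either frees the colour of the edge of `M` at its last
vertex or augments `M`. -/
theorem exists_switch (hp : IsAltPath π T M Out t g a b) (htL : t ≤ L)
    (hEs : ∀ c u v, E c u v → E c v u) (hE : ∀ c v, ¬ E c v v)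
    (hM : IsRainbowFinset E M) (hmax : ∀ X, IsRainbowFinset E X → #X ≤ #M)
    (hsw : ∀ c ∈ C, IsSwitch E M c (h c) (sw c)) (hTC : ∀ g ∈ T, g.1 ∈ C)
    (hTE : ∀ g ∈ T, E g.1 g.2 (π g.1 g.2))
    (hOut : ∀ v ∈ Out, ∃ e ∈ M, Sum.inl v ∈ edgeItems e ∧ e.1 ∉ C)
    (hconf : ∀ r ≤ L, ∀ g a b,
        (IsDartWalk π T (partner M) r g a b →
          ∀ z, a 0 = z ∨ a 0 = partner M z → Sum.inl z ∉ h (g r).1) ∧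
        (IsDartWalk π T (partner M) (r + 1) g a b → Disjoint (h (g 0).1) (h (g (r + 1)).1))) :
    ∃ e ∈ M, Sum.inl (b t) ∈ edgeItems e ∧ e.1 ∉ C ∧ b t ∈ Out ∧
      ∃ sw', IsSwitch E M e.1 (home M h t g a b) sw' := by
  have hinv := partner_involutive hM hE
  have hCg : ∀ j ≤ t, (g j).1 ∈ C := fun j hj => hTC _ (hp.mem j hj)
  have hlt : ∀ i j, i < j → j ≤ t → Disjoint (h (g i).1) (h (g j).1) := by
    intro i j hij hj
    have h1 := (hconf (j - i - 1) (by omega) _ _ _).2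
      (hp.walk (i := i) (r := j - i - 1 + 1) (by omega))
    rwa [show i + (j - i - 1 + 1) = j by omega, add_zero] at h1
  have hdisne : ∀ i ≤ t, ∀ j ≤ t, i ≠ j → Disjoint (h (g i).1) (h (g j).1) := by
    intro i hi j hj hij
    rcases lt_or_gt_of_ne hij with h1 | h1
    · exact hlt i j h1 hj
    · exact (hlt j i h1 hi).symm
  have hcolne : ∀ i ≤ t, ∀ j ≤ t, i ≠ j → (g i).1 ≠ (g j).1 := by
    intro i hi j hj hij heq
    have h1 := hdisne i hi j hj hij
    rw [heq] at h1
    exact Finset.disjoint_left.1 h1 (hsw _ (hCg j hj)).self (hsw _ (hCg j hj)).self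
  -- Darts from `g j` onwards are reached forwards from `a j`. Earlier ones are reached backwards
  -- from `b (j - 1)`, the partner of `a j`; hence the two alternatives for `a 0` in `hconf`.
  have ha_home : ∀ j ≤ t, ∀ i ≤ t, Sum.inl (a j) ∉ h (g i).1 := by
    intro j hj i hi
    rcases le_or_gt j i with hji | hji
    · have h1 := (hconf (i - j) (by omega) _ _ _).1 (hp.walk (i := j) (r := i - j) (by omega))
        (a j) (Or.inl rfl)
      rwa [show j + (i - j) = i by omega] at h1
    · have h1 := (hconf (j - 1 - i) (by omega) _ _ _).1
        (hp.reverse_walk hinv (j := j - 1) (r := j - 1 - i) (by omega) (by omega)) (a j)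
        (Or.inr (by
          have h2 := hp.step (j - 1) (by omega)
          rw [show j - 1 + 1 = j by omega] at h2
          simp only [Nat.sub_zero]
          rw [← h2, hinv]))
      rwa [show j - 1 - (j - 1 - i) = i by omega] at h1
  have hb_home : ∀ j ≤ t, ∀ i ≤ t, Sum.inl (b j) ∉ h (g i).1 := by
    intro j hj i hi
    rcases le_or_gt i j with hji | hji
    · have h1 := (hconf (j - i) (by omega) _ _ _).1
        (hp.reverse_walk hinv (j := j) (r := j - i) (by omega) (by omega)) (b j) (Or.inl rfl)
      rwa [show j - (j - i) = i by omega] at h1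
    · have h1 := (hconf (i - (j + 1)) (by omega) _ _ _).1
        (hp.walk (i := j + 1) (r := i - (j + 1)) (by omega)) (b j)
        (Or.inr (hp.step j (by omega)).symm)
      rwa [show j + 1 + (i - (j + 1)) = i by omega] at h1
  set Q : Finset κ := (range (t + 1)).image fun j => (g j).1 with hQ
  have hQm : ∀ c ∈ Q, ∃ j ≤ t, (g j).1 = c := by
    intro c hc
    obtain ⟨j, hj, rfl⟩ := mem_image.1 hc
    exact ⟨j, by have := mem_range.1 hj; omega, rfl⟩
  let edge : ℕ → κ × V × V := fun j => ((g j).1, a j, b j)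
  set D : Finset (κ × V × V) := (range (t + 1)).image edge with hDdef
  have hDm : ∀ e ∈ D, ∃ j ≤ t, e = ((g j).1, a j, b j) := by
    intro c hc
    obtain ⟨j, hj, rfl⟩ := mem_image.1 hc
    exact ⟨j, by have := mem_range.1 hj; omega, rfl⟩
  have hDcard : #D = t + 1 := by
    rw [hDdef, card_image_of_injOn, card_range]
    intro i hi j hj hij
    simp only [coe_range, Set.mem_Iio] at hi hj
    exact hp.a_inj i (by omega) j (by omega) (congrArg (fun e => e.2.1) hij)
  -- These are all the edges of `M` that meet the path: `a 0` is uncovered and every other `a j` is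
  -- the partner of `b (j - 1)`.
  set A : Finset (κ × V × V) :=
    (range (t + 1)).biUnion fun j => M.filter fun e => Sum.inl (b j) ∈ edgeItems e with hA
  have hAm : ∀ j ≤ t, ∀ f ∈ M, Sum.inl (b j) ∈ edgeItems f → f ∈ A := by
    intro j hj f hf hb
    exact mem_biUnion.2 ⟨j, mem_range.2 (by omega), mem_filter.2 ⟨hf, hb⟩⟩
  have hD : IsRainbowFinset E D := by
    constructor
    · intro e he
      obtain ⟨j, hj, rfl⟩ := hDm e he
      have h1 := hTE _ (hp.mem j hj)
      rcases hp.joins j hj with ⟨h2, h3⟩ | ⟨h2, h3⟩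
      · simp only
        rwa [← h3, ← h2]
      · simp only
        rw [← h3, ← h2]
        exact hEs _ _ _ h1
    · intro e he f hf hef
      obtain ⟨i, hi, rfl⟩ := hDm e he
      obtain ⟨j, hj, rfl⟩ := hDm f hf
      have hij : i ≠ j := by rintro rfl; exact hef rfl
      rw [Finset.disjoint_left]
      rintro (v | c) h1 h2
      · rw [inl_mem_edgeItems] at h1 h2
        simp only at h1 h2
        rcases h1 with rfl | rfl <;> rcases h2 with h2 | h2
        · exact hij (hp.a_inj i hi j hj h2)
        · exact hp.ne i hi j hj h2
        · exact hp.ne j hj i hi h2.symm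
        · exact hij (hp.b_inj i hi j hj h2)
      · rw [inr_mem_edgeItems] at h1 h2
        exact hcolne i hi j hj hij (h1.symm.trans h2)
  obtain ⟨M', hM', hcard, hrem, hadd⟩ := exists_combined_switch hM (Q := Q) (h := h) (sw := sw)
    (fun c hc => by
      obtain ⟨j, hj, rfl⟩ := hQm c hc
      exact hsw _ (hCg j hj))
    (fun c hc d hd hcd => by
      obtain ⟨i, hi, rfl⟩ := hQm c hc
      obtain ⟨j, hj, rfl⟩ := hQm d hd
      exact hdisne i hi j hj (by rintro rfl; exact hcd rfl))
    (A := A) (D := D) hD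
    (fun e he => by
      obtain ⟨j, hj, rfl⟩ := hDm e he
      exact mem_image.2 ⟨j, mem_range.2 (by omega), rfl⟩)
    (fun e he v hv f hf hvf => by
      obtain ⟨j, hj, rfl⟩ := hDm e he
      rcases inl_mem_edgeItems.1 hv with h1 | h1
      · simp only at h1
        subst h1
        rcases Nat.eq_zero_or_pos j with rfl | hj0
        · exact absurd hp.start (partner_mem hM hE hf hvf).2
        · have h2 := hp.step (j - 1) (by omega)
          rw [show j - 1 + 1 = j by omega] at h2
          refine hAm (j - 1) (by omega) f hf ?_
          rw [← hinv (b (j - 1)), h2]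
          exact (partner_mem hM hE hf hvf).1
      · simp only at h1
        subst h1
        exact hAm j hj f hf hvf)
    (fun e he v hv c hc => by
      obtain ⟨j, hj, rfl⟩ := hDm e he
      obtain ⟨i, hi, rfl⟩ := hQm c hc
      rcases inl_mem_edgeItems.1 hv with h1 | h1
      · simp only at h1
        subst h1
        exact ha_home j hj i hi
      · simp only at h1
        subst h1
        exact hb_home j hj i hi)
  -- If `b t` were uncovered, `A` would have at most t edges against the t + 1 of `D`, and `M'`
  -- would exceed the maximum.
  have hbt : b t ∈ Out := by
    rcases hp.last with h1 | h1
    · exact h1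
    · exfalso
      have h2 : A ⊆ (range t).biUnion fun j => M.filter fun e => Sum.inl (b j) ∈ edgeItems e := by
        intro e he
        obtain ⟨j, hj, hej⟩ := mem_biUnion.1 he
        refine mem_biUnion.2 ⟨j, mem_range.2 ?_, hej⟩
        have hj' := mem_range.1 hj
        rcases Nat.lt_or_ge j t with h3 | h3
        · exact h3
        · have : j = t := by omega
          subst this
          exact absurd h1 (partner_mem hM hE (mem_filter.1 hej).1 (mem_filter.1 hej).2).2
      have h3 := (card_le_card h2).trans (card_biUnion_le_card_mul _ _ 1
        fun j _ => card_filter_mem_le_one hM _)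
      rw [card_range] at h3
      have := hmax M' hM'
      omega
  obtain ⟨e, he, hbe, heC⟩ := hOut _ hbt
  have hAcard : #A ≤ t + 1 := by
    have h3 := (card_biUnion_le_card_mul (range (t + 1))
      (fun j => M.filter fun e => Sum.inl (b j) ∈ edgeItems e) 1
        fun j _ => card_filter_mem_le_one hM _)
    rw [card_range] at h3
    rw [hA]
    omega
  have hhome : ∀ j ≤ t, h (g j).1 ⊆ home M h t g a b := by
    intro j hj z hz
    exact mem_biUnion.2 ⟨j, mem_range.2 (by omega), mem_union_right _ hz⟩
  have hAhome : ∀ f ∈ A, edgeItems f ⊆ home M h t g a b := by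
    intro f hf z hz
    obtain ⟨j, hj, hf⟩ := mem_biUnion.1 hf
    exact mem_biUnion.2 ⟨j, hj, mem_union_left _ (mem_union_left _ (mem_biUnion.2 ⟨f, hf, hz⟩))⟩
  refine ⟨e, he, hbe, heC, hbt, M', hM', by omega, ?_, ?_, ?_, ?_⟩
  · intro f hf hfe
    rcases hadd f hf with ⟨h1, h2⟩ | h1 | ⟨c, hc, h1, h2⟩
    · have : f = e := hM.injOn_colour h1 he hfe
      exact h2 (this ▸ hAm t le_rfl e he hbe)
    · obtain ⟨j, hj, rfl⟩ := hDm f h1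
      exact heC (hfe ▸ hCg j hj)
    · obtain ⟨j, hj, rfl⟩ := hQm c hc
      have h3 := hsw _ (hCg j hj)
      -- A switch can reuse the colour of `e` only by removing `e`, and then its home would contain
      -- `b t`.
      have h4 : e ∉ sw (g j).1 := fun h4 => h2 (h3.rainbow.injOn_colour h1 h4 hfe ▸ he)
      exact hb_home t le_rfl j hj (h3.removed e he h4 hbe)
  · intro f hf hf'
    rcases hrem f hf hf' with h1 | ⟨c, hc, h1⟩
    · exact hAhome f h1
    · obtain ⟨j, hj, rfl⟩ := hQm c hc
      exact h1.trans (hhome j hj)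
  · intro f hf hf'
    rcases hadd f hf with ⟨h1, _⟩ | h1 | ⟨c, hc, h1, h2⟩
    · exact absurd h1 hf'
    · obtain ⟨j, hj, rfl⟩ := hDm f h1
      intro z hz
      have h5 : j ∈ range (t + 1) := mem_range.2 (by omega)
      rcases mem_edgeItems.1 hz with rfl | rfl | rfl
      · exact mem_biUnion.2 ⟨j, h5, by simp⟩
      · exact mem_biUnion.2 ⟨j, h5, by simp⟩
      · exact hhome j hj (hsw _ (hCg j hj)).self
    · obtain ⟨j, hj, rfl⟩ := hQm c hc
      exact ((hsw _ (hCg j hj)).added f h1 h2).trans (hhome j hj)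
  · exact hAhome e (hAm t le_rfl e he hbe) (inr_mem_edgeItems.2 rfl)

end IsAltPath

end PathSwitch

/-! ### Disjoint alternating paths from the perfect matching. -/

section Paths

open scoped Classical
open Finset

variable {V κ : Type*} [Fintype V] {E : κ → V → V → Prop} {M : Finset (κ × V × V)}

/-- The vertices covered by the edges of `M`. -/
noncomputable def coveredVerts (M : Finset (κ × V × V)) : Finset V :=
  univ.filter fun v => ∃ e ∈ M, Sum.inl v ∈ edgeItems e

lemma mem_coveredVerts {v : V} :
    v ∈ coveredVerts M ↔ ∃ e ∈ M, Sum.inl v ∈ edgeItems e := by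
  simp [coveredVerts]

lemma card_coveredVerts (hM : IsRainbowFinset E M) (hE : ∀ c v, ¬ E c v v) :
    #(coveredVerts M) = 2 * #M := by
  have h1 : coveredVerts M = M.biUnion fun e => {e.2.1, e.2.2} := by
    ext v
    simp [mem_coveredVerts, inl_mem_edgeItems]
  rw [h1, card_biUnion, Finset.sum_const_nat (m := 2), mul_comm]
  · intro e he
    refine Finset.card_pair fun h => ?_
    have := hM.edge e he
    rw [h] at this
    exact hE _ _ this
  · intro e he f hf hef
    refine Finset.disjoint_left.2 fun v hv hv' => hef ?_
    simp only [mem_insert, mem_singleton] at hv hv'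
    exact hM.eq_of_mem he hf (inl_mem_edgeItems.2 hv) (inl_mem_edgeItems.2 hv')

/-- The system of disjoint alternating paths given by a perfect matching of the auxiliary graph. -/
theorem exists_altPaths [Nonempty κ] (hM : IsRainbowFinset E M) (hE : ∀ c v, ¬ E c v v)
    {π : κ → Equiv.Perm V} {T : Finset (κ × V)} {Out : Finset V} {d : ℕ}
    (hOut : Out ⊆ coveredVerts M) (hOutM : ∀ v ∈ Out, partner M v ∈ Out)
    {N : V ⊕ Fin d → V ⊕ Fin d} (hN : Function.Involutive N) (hN1 : ∀ x, N x ≠ x)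
    (hNT : ∀ u x, u ∉ Out → N (Sum.inl u) = Sum.inl x → ∃ g ∈ T, DartJoins π g u x) :
    ∃ (W : Finset V) (t : V → ℕ) (g : V → ℕ → κ × V) (a b : V → ℕ → V),
      Fintype.card V ≤ #W + d + 2 * #M ∧
      (∀ w ∈ W, IsAltPath π T M Out (t w) (g w) (a w) (b w)) ∧
      (∀ w ∈ W, ∀ w' ∈ W, ∀ i ≤ t w, ∀ j ≤ t w', a w i = a w' j → w = w') ∧
      (∀ w ∈ W, ∀ w' ∈ W, ∀ i ≤ t w, ∀ j ≤ t w', b w i = b w' j → w = w') ∧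
      ∀ L, #(W.filter fun w => L ≤ t w) * L ≤ 2 * #M := by
  have hinv := partner_involutive hM hE
  -- Fixing Out and the dummies makes a path stop as soon as it reaches one of them, or an uncovered
  -- vertex.
  let P : V ⊕ Fin d → V ⊕ Fin d := Sum.map (fun v => if v ∈ Out then v else partner M v) id
  have hPin : ∀ v, v ∈ Out → P (Sum.inl v) = Sum.inl v := fun v hv => by simp [P, hv]
  have hPout : ∀ v, v ∉ Out → P (Sum.inl v) = Sum.inl (partner M v) := fun v hv => by
    simp [P, hv]
  have hPr : ∀ i, P (Sum.inr i) = Sum.inr i := fun i => rfl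
  have hPinv : Function.Involutive P := by
    rintro (v | i)
    · by_cases hv : v ∈ Out
      · rw [hPin v hv, hPin v hv]
      · rw [hPout v hv, hPout _ fun h => hv (by rw [← hinv v]; exact hOutM _ h), hinv]
    · rw [hPr, hPr]
  have hPne : ∀ y, P y ≠ y → ∃ v, y = Sum.inl v ∧ v ∉ Out ∧ P y = Sum.inl (partner M v) ∧
      v ∈ coveredVerts M := by
    rintro (v | i) hy
    · by_cases hv : v ∈ Out
      · exact absurd (hPin v hv) hy
      · refine ⟨v, rfl, hv, hPout v hv, ?_⟩
        by_contra hc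
        rw [mem_coveredVerts] at hc
        push Not at hc
        rw [hPout v hv, partner_of_not_covered hc] at hy
        exact hy rfl
    · exact absurd (hPr i) hy
  set U : Finset V := (coveredVerts M)ᶜ with hU
  have hUout : ∀ w ∈ U, w ∉ Out := fun w hw h => (mem_compl.1 hw) (hOut h)
  have hUpart : ∀ w ∈ U, partner M w = w := fun w hw => by
    refine partner_of_not_covered fun e he hwe => mem_compl.1 hw (mem_coveredVerts.2 ⟨e, he, hwe⟩)
  have hUP : ∀ w ∈ U, P (Sum.inl w) = Sum.inl w := fun w hw => by
    rw [hPout w (hUout w hw), hUpart w hw]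
  have hex : ∀ w : V, ∃ t, w ∈ U → IsAltStop N P (Sum.inl w) t := fun w => by
    by_cases hw : w ∈ U
    · obtain ⟨t, ht⟩ := exists_isAltStop hN hPinv (hUP w hw)
      exact ⟨t, fun _ => ht⟩
    · exact ⟨0, fun h => absurd h hw⟩
  choose t ht using hex
  let u : V → ℕ → V ⊕ Fin d := fun w j => (P ∘ N)^[j] (Sum.inl w)
  -- The default w is never taken on paths from `W`: a dummy can only be the last vertex, and `W`
  -- excludes this.
  let a : V → ℕ → V := fun w j => Sum.elim id (fun _ => w) (u w j)
  let b : V → ℕ → V := fun w j => Sum.elim id (fun _ => w) (N (u w j))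
  set W : Finset V := U.filter fun w => ∃ x, N (u w (t w)) = Sum.inl x with hW
  have hWU : ∀ w ∈ W, w ∈ U := fun w hw => (mem_filter.1 hw).1
  have hua : ∀ w ∈ U, ∀ j ≤ t w, u w j = Sum.inl (a w j) ∧ a w j ∉ Out := by
    intro w hw j hj
    rcases Nat.eq_zero_or_pos j with rfl | hj0
    · exact ⟨rfl, hUout w hw⟩
    · obtain ⟨v, hv, hvo, _⟩ := hPne _ ((ht w hw).ne_fixed hPinv hj0 hj)
      have h1 : u w j = Sum.inl v := hv
      have h2 : a w j = v := by simp only [a, h1, Sum.elim_inl, id]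
      rw [h2]
      exact ⟨h1, hvo⟩
  have hub : ∀ w ∈ W, ∀ j ≤ t w, N (u w j) = Sum.inl (b w j) := by
    intro w hw j hj
    have h0 : ∃ x, N (u w j) = Sum.inl x := by
      rcases Nat.lt_or_ge j (t w) with h1 | h1
      · obtain ⟨v, hv, _⟩ := hPne _ ((ht w (hWU w hw)).1 j h1)
        exact ⟨v, hv⟩
      · rw [show j = t w by omega]
        exact (mem_filter.1 hw).2
    obtain ⟨x, hx⟩ := h0
    rw [hx]
    simp only [b, hx, Sum.elim_inl, id]
  have hdart : ∀ w j, ∃ g : κ × V, w ∈ W → j ≤ t w → g ∈ T ∧ DartJoins π g (a w j) (b w j) := by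
    intro w j
    by_cases h : w ∈ W ∧ j ≤ t w
    · obtain ⟨hw, hj⟩ := h
      obtain ⟨h1, h2⟩ := hua w (hWU w hw) j hj
      obtain ⟨g, hg, hg'⟩ := hNT _ (b w j) h2 (by rw [← h1]; exact hub w hw j hj)
      exact ⟨g, fun _ _ => ⟨hg, hg'⟩⟩
    · exact ⟨(Classical.arbitrary κ, w), fun h1 h2 => absurd ⟨h1, h2⟩ h⟩
  choose g hg using hdart
  have hstep : ∀ w ∈ W, ∀ j < t w, partner M (b w j) = a w (j + 1) ∧ b w j ∉ Out := by
    intro w hw j hj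
    have h1 := hub w hw j hj.le
    obtain ⟨v, hv, hvo, hPv, _⟩ := hPne _ ((ht w (hWU w hw)).1 j hj)
    have h2 : Sum.inl v = Sum.inl (b w j) := hv.symm.trans h1
    rw [Sum.inl.injEq] at h2
    subst h2
    have h3 : u w (j + 1) = Sum.inl (partner M (b w j)) := by
      simp only [u]
      rw [Function.iterate_succ_apply']
      exact hPv
    rw [(hua w (hWU w hw) (j + 1) hj).1, Sum.inl.injEq] at h3
    exact ⟨h3.symm, hvo⟩
  have hu_inj : ∀ w ∈ U, ∀ w' ∈ U, ∀ i ≤ t w, ∀ j ≤ t w', u w i = u w' j → w = w' ∧ i = j := by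
    intro w hw w' hw' i hi j hj hij
    obtain ⟨h1, h2⟩ := IsAltStop.eq_of_iterate_eq hN hPinv (hUP w hw) (hUP w' hw') (ht w hw)
      (ht w' hw') hi hj hij
    exact ⟨Sum.inl_injective h1, h2⟩
  have ha_inj : ∀ w ∈ W, ∀ w' ∈ W, ∀ i ≤ t w, ∀ j ≤ t w', a w i = a w' j → w = w' ∧ i = j := by
    intro w hw w' hw' i hi j hj hij
    refine hu_inj w (hWU w hw) w' (hWU w' hw') i hi j hj ?_
    rw [(hua w (hWU w hw) i hi).1, (hua w' (hWU w' hw') j hj).1, hij]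
  have hb_inj : ∀ w ∈ W, ∀ w' ∈ W, ∀ i ≤ t w, ∀ j ≤ t w', b w i = b w' j → w = w' ∧ i = j := by
    intro w hw w' hw' i hi j hj hij
    refine hu_inj w (hWU w hw) w' (hWU w' hw') i hi j hj (hN.injective ?_)
    rw [hub w hw i hi, hub w' hw' j hj, hij]
  refine ⟨W, t, g, a, b, ?_, fun w hw => ?_, fun w hw w' hw' i hi j hj hij =>
    (ha_inj w hw w' hw' i hi j hj hij).1, fun w hw w' hw' i hi j hj hij =>
    (hb_inj w hw w' hw' i hi j hj hij).1, fun L => ?_⟩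
  -- Disjoint paths end at different dummies, so at most d uncovered vertices are lost.
  · have h1 : #(U.filter fun w => ¬ ∃ x, N (u w (t w)) = Sum.inl x) ≤ d := by
      have h2 : #(U.filter fun w => ¬ ∃ x, N (u w (t w)) = Sum.inl x) ≤
          #((univ : Finset (Fin d)).image (Sum.inr : Fin d → V ⊕ Fin d)) := by
        refine Finset.card_le_card_of_injOn (fun w => N (u w (t w))) ?_ ?_
        · intro w hw
          obtain ⟨_, h3⟩ := mem_filter.1 hw
          rcases h4 : N (u w (t w)) with x | i
          · exact absurd ⟨x, h4⟩ h3
          · simp [h4]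
        · intro w hw w' hw' heq
          exact (hu_inj w (mem_filter.1 hw).1 w' (mem_filter.1 hw').1 _ le_rfl _ le_rfl
            (hN.injective heq)).1
      refine h2.trans (card_image_le.trans ?_)
      rw [card_univ, Fintype.card_fin]
    have h2 : #W + #(U.filter fun w => ¬ ∃ x, N (u w (t w)) = Sum.inl x) = #U := by
      rw [hW]
      exact Finset.card_filter_add_card_filter_not _
    have h3 : #U + 2 * #M = Fintype.card V := by
      rw [hU, ← card_coveredVerts hM hE, card_compl_add_card]
    omega
  · refine ⟨fun j hj => (hg w j hw hj).1, fun j hj => (hg w j hw hj).2,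
      fun j hj => (hstep w hw j hj).1, fun i hi j hj hij => (ha_inj w hw w hw i hi j hj hij).2,
      fun i hi j hj hij => (hb_inj w hw w hw i hi j hj hij).2, fun i hi j hj hij => ?_,
      hUpart w (hWU w hw), ?_⟩
    · refine (ht w (hWU w hw)).iterate_ne_apply hN hPinv hN1 hi hj ?_
      change u w i = N (u w j)
      rw [(hua w (hWU w hw) i hi).1, hub w hw j hj, hij]
    · by_contra hcon
      push Not at hcon
      have h1 := (ht w (hWU w hw)).2
      change P (N (u w (t w))) = N (u w (t w)) at h1
      rw [hub w hw _ le_rfl, hPout _ hcon.1, Sum.inl.injEq] at h1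
      exact hcon.2 h1
  · have h1 := IsAltStop.card_mul_le hN hPinv ((W.filter fun w => L ≤ t w).image Sum.inl)
      ((coveredVerts M).image Sum.inl) (fun y => Sum.elim t (fun _ => 0) y)
      (by
        intro y hy
        obtain ⟨w, hw, rfl⟩ := mem_image.1 hy
        exact hUP w (hWU w (mem_filter.1 hw).1))
      (by
        intro y hy
        obtain ⟨w, hw, rfl⟩ := mem_image.1 hy
        exact ht w (hWU w (mem_filter.1 hw).1))
      (by
        intro y hy
        obtain ⟨v, rfl, _, _, hv⟩ := hPne y hy
        exact mem_image_of_mem _ hv)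
      (L := L)
      (by
        intro y hy
        obtain ⟨w, hw, rfl⟩ := mem_image.1 hy
        exact (mem_filter.1 hw).2)
    rw [card_image_of_injective _ Sum.inl_injective,
      card_image_of_injective _ Sum.inl_injective, card_coveredVerts hM hE] at h1
    exact h1

end Paths

/-! ### From one stage to the next. -/

section Stages

open scoped Classical
open Finset

variable {V κ : Type*} [Fintype V] {E : κ → V → V → Prop}
  {M : Finset (κ × V × V)}

/-- Every colour in `C`, in particular every colour that is missing in `M`, can be freed by a
switch, where the switches have bounded size and no vertex or colour is affected by many of
them. -/
structure IsStage (E : κ → V → V → Prop) (M : Finset (κ × V × V)) (ℓ s : ℕ) (C : Finset κ)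
    (h : κ → Finset (V ⊕ κ)) (sw : κ → Finset (κ × V × V)) : Prop where
  missing : ∀ c, (∀ e ∈ M, e.1 ≠ c) → c ∈ C
  switch : ∀ c ∈ C, IsSwitch E M c (h c) (sw c)
  card_home : ∀ c ∈ C, #(h c) ≤ ℓ
  congestion : ∀ z, #(C.filter fun c => z ∈ h c) ≤ s

/-- The vertices of the edges of `M` whose colour is not in `C`. -/
noncomputable def outVerts (M : Finset (κ × V × V)) (C : Finset κ) : Finset V :=
  coveredVerts (M.filter fun e => e.1 ∉ C)

lemma mem_outVerts {C : Finset κ} {v : V} :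
    v ∈ outVerts M C ↔ ∃ e ∈ M, Sum.inl v ∈ edgeItems e ∧ e.1 ∉ C := by
  simp only [outVerts, mem_coveredVerts, mem_filter]
  exact ⟨fun ⟨e, ⟨h1, h2⟩, h3⟩ => ⟨e, h1, h3, h2⟩, fun ⟨e, h1, h3, h2⟩ => ⟨e, ⟨h1, h2⟩, h3⟩⟩

variable [Fintype κ]

/-- As C contains all missing colours, each colour outside C is carried by exactly one edge of `M`,
which contributes two vertices. -/
lemma card_outVerts (hM : IsRainbowFinset E M) (hE : ∀ c v, ¬ E c v v) {C : Finset κ}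
    (hC : ∀ c, (∀ e ∈ M, e.1 ≠ c) → c ∈ C) :
    #(outVerts M C) + 2 * #C = 2 * Fintype.card κ := by
  have hM' : IsRainbowFinset E (M.filter fun e => e.1 ∉ C) :=
    ⟨fun e he => hM.edge e (mem_filter.1 he).1, fun e he f hf =>
      hM.disj e (mem_filter.1 he).1 f (mem_filter.1 hf).1⟩
  have h1 : (M.filter fun e => e.1 ∉ C).image Prod.fst = Cᶜ := by
    ext c
    simp only [mem_image, mem_filter, mem_compl]
    constructor
    · rintro ⟨e, ⟨_, h⟩, rfl⟩
      exact h
    · intro hc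
      by_contra hcon
      push Not at hcon
      refine hc (hC c fun e he hec => hcon e ⟨he, by rwa [hec]⟩ hec)
  have h2 : #(M.filter fun e => e.1 ∉ C) = #Cᶜ := by
    rw [← h1, card_image_of_injOn hM'.injOn_colour]
  rw [outVerts, card_coveredVerts hM' hE, h2, ← Nat.mul_add, card_compl_add_card]

/-- A sparse set of darts without short conflicts makes it possible to free many new colours. -/
theorem IsStage.exists_next [Nonempty κ] {ℓ s : ℕ} {C : Finset κ} {h : κ → Finset (V ⊕ κ)}
    {sw : κ → Finset (κ × V × V)} (hst : IsStage E M ℓ s C h sw)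
    (hEs : ∀ c u v, E c u v → E c v u) (hE : ∀ c v, ¬ E c v v) (hM : IsRainbowFinset E M)
    (hmax : ∀ X, IsRainbowFinset E X → #X ≤ #M) {π : κ → Equiv.Perm V} {T : Finset (κ × V)}
    {B k L : ℕ} (hB : 0 < B) (hk : #M + k = Fintype.card κ) (hL0 : 0 < L)
    (hL : 4 * Fintype.card κ ≤ L * k) (hTC : ∀ g ∈ T, g.1 ∈ C)
    (hTE : ∀ g ∈ T, E g.1 g.2 (π g.1 g.2)) (hTOut : ∀ g ∈ T, g.2 ∉ outVerts M C)
    (hout : ∀ v, #(T.filter fun g => g.2 = v) ≤ B)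
    (hin : ∀ v, #(T.filter fun g => π g.1 g.2 = v) ≤ B)
    (hK : ∀ K : Finset V, K.Nonempty → Disjoint K (outVerts M C) →
      #(T.filter fun g => g.2 ∈ K ∧ π g.1 g.2 ∈ K) ≤ B * (#K - 1))
    (hcol : ∀ c, #(T.filter fun g => g.1 = c) ≤ 2 * B)
    (hcount : B * (2 * #C + 2) ≤ #T + B * k)
    (hconf : ∀ r ≤ L, ∀ g a b,
        (IsDartWalk π T (partner M) r g a b →
          ∀ z, a 0 = z ∨ a 0 = partner M z → Sum.inl z ∉ h (g r).1) ∧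
        (IsDartWalk π T (partner M) (r + 1) g a b → Disjoint (h (g 0).1) (h (g (r + 1)).1))) :
    ∃ C' h' sw', IsStage E M ((L + 1) * (5 + ℓ)) (s + (4 + 4 * B * s)) C' h' sw' ∧
      4 * #C + k ≤ 4 * #C' := by
  set Out := outVerts M C with hOut
  have hOutcard := card_outVerts hM hE hst.missing
  rw [← hOut] at hOutcard
  -- the number of dummy vertices
  set q := #T / B with hq
  have hq1 : B * q ≤ #T := Nat.mul_div_le _ _
  have hq2 : #T < B * (q + 1) := Nat.lt_mul_div_succ _ hB
  have hq3 : q + #Out ≤ Fintype.card V := by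
    have h1 : #T ≤ B * #Outᶜ := by
      refine (Finset.card_le_mul_card_image (f := fun g => g.2) _ B fun v _ => hout v).trans ?_
      refine Nat.mul_le_mul_left _ (card_le_card ?_)
      intro v hv
      obtain ⟨g, hg, rfl⟩ := mem_image.1 hv
      exact mem_compl.2 (hTOut g hg)
    have h2 : q ≤ #Outᶜ := Nat.le_of_mul_le_mul_left (hq1.trans h1) hB
    have h3 := card_compl_add_card Out
    omega
  have hq4 : 2 * #C + 2 ≤ q + k := by
    have h1 : B * (2 * #C + 2) < B * (q + 1 + k) := by
      rw [Nat.mul_add B (q + 1) k]; omega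
    have := Nat.lt_of_mul_lt_mul_left h1
    omega
  -- The count in Tutte's condition asks for |V| + 1 - |Out| - q dummies; parity may force one more.
  obtain ⟨d, hd1, hd2, hpar⟩ : ∃ d, Fintype.card V + 1 ≤ d + #Out + q ∧
      d + #Out + q ≤ Fintype.card V + 2 ∧ Even (Fintype.card V + d) := by
    rcases Nat.even_or_odd (Fintype.card V + (Fintype.card V + 1 - #Out - q)) with h1 | h1
    · exact ⟨Fintype.card V + 1 - #Out - q, by omega, by omega, h1⟩
    · exact ⟨Fintype.card V + 1 - #Out - q + 1, by omega, by omega, by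
        rw [← add_assoc]; exact h1.add_one⟩
  have hTne : ∀ g ∈ T, π g.1 g.2 ≠ g.2 := fun g hg heq => by
    have := hTE g hg
    rw [heq] at this
    exact hE _ _ this
  obtain ⟨N, hN, hN1, hNT⟩ := exists_involution_of_sparse hB hTOut hout hin hK (d := d)
    (by
      have h1 := Nat.mul_le_mul_left B hd1
      rw [Nat.mul_add B (d + #Out) q, Nat.mul_add B d] at h1
      omega) hpar
  have hOutsub : Out ⊆ coveredVerts M := by
    intro v hv
    obtain ⟨e, he, hve, _⟩ := mem_outVerts.1 hv
    exact mem_coveredVerts.2 ⟨e, he, hve⟩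
  obtain ⟨W, t, g, a, b, hWcard, hpath, ha, hb, hlen⟩ := exists_altPaths hM hE hOutsub
    (fun v hv => by
      obtain ⟨e, he, hve, heC⟩ := mem_outVerts.1 hv
      exact mem_outVerts.2 ⟨e, he, (partner_mem hM hE he hve).1, heC⟩) hN hN1 hNT
  -- |W| ≥ |V| - d - 2|M| ≥ |Out| + q - 2 - 2|M| = 2k + q - 2|C| - 2, and `hq4` bounds this below by
  -- k.
  have hWk : k ≤ #W := by omega
  set G := W.filter fun w => ¬ L ≤ t w with hG
  have hGW : ∀ w ∈ G, w ∈ W := fun w hw => (mem_filter.1 hw).1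
  -- Disjointness leaves at most 2|M|/L ≤ k/2 long paths.
  have hGcard : k ≤ 2 * #G := by
    have h1 : #(W.filter fun w => L ≤ t w) + #G = #W :=
      Finset.card_filter_add_card_filter_not _
    have h2 := hlen L
    have h3 : L * (2 * #(W.filter fun w => L ≤ t w)) ≤ L * k := by
      rw [show L * (2 * #(W.filter fun w => L ≤ t w)) =
        2 * (#(W.filter fun w => L ≤ t w) * L) by ring]
      omega
    have h4 := Nat.le_of_mul_le_mul_left h3 hL0
    omega
  have hsw : ∀ w, ∃ e sw', w ∈ G → e ∈ M ∧ Sum.inl (b w (t w)) ∈ edgeItems e ∧ e.1 ∉ C ∧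
      IsSwitch E M e.1 (IsAltPath.home M h (t w) (g w) (a w) (b w)) sw' := by
    intro w
    by_cases hw : w ∈ G
    · obtain ⟨e, he, h1, h2, _, sw', h3⟩ := (hpath w (hGW w hw)).exists_switch (L := L) (C := C)
        (h := h) (sw := sw) (not_le.1 (mem_filter.1 hw).2).le hEs hE hM hmax hst.switch hTC hTE
        (fun v hv => mem_outVerts.1 hv) hconf
      exact ⟨e, sw', fun _ => ⟨he, h1, h2, h3⟩⟩
    · exact ⟨(Classical.arbitrary κ, w, w), ∅, fun h => absurd h hw⟩
  choose e swN hsw using hsw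
  set Cn := G.image fun w => (e w).1 with hCn
  have hCnC : Disjoint C Cn := by
    rw [Finset.disjoint_right]
    intro c hc
    obtain ⟨w, hw, rfl⟩ := mem_image.1 hc
    exact (hsw w hw).2.2.1
  -- Paths have different last vertices, and an edge of `M` has only two ends.
  have hCncard : #G ≤ 2 * #Cn := by
    refine Finset.card_le_mul_card_image (f := fun w => (e w).1) _ 2 fun c hc => ?_
    obtain ⟨w0, hw0, rfl⟩ := mem_image.1 hc
    refine (Finset.card_le_card_of_injOn (t := {(e w0).2.1, (e w0).2.2})
      (fun w => b w (t w)) ?_ ?_).trans Finset.card_le_two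
    · intro w hw
      obtain ⟨hw, hww⟩ := mem_filter.1 hw
      have h1 : e w = e w0 := hM.injOn_colour (hsw w hw).1 (hsw w0 hw0).1 hww
      have h2 := inl_mem_edgeItems.1 (hsw w hw).2.1
      rw [h1] at h2
      simpa using h2
    · intro w hw w' hw' hbb
      exact hb w (hGW w (mem_filter.1 hw).1) w' (hGW w' (mem_filter.1 hw').1) _ le_rfl _ le_rfl hbb
  have hpick : ∀ c : κ, ∃ w, c ∈ Cn → w ∈ G ∧ (e w).1 = c := by
    intro c
    by_cases hc : c ∈ Cn
    · obtain ⟨w, hw, hwc⟩ := mem_image.1 hc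
      exact ⟨w, fun _ => ⟨hw, hwc⟩⟩
    · by_cases hne : Nonempty V
      · exact ⟨hne.some, fun h => absurd h hc⟩
      · exfalso
        have hV : Fintype.card V = 0 := by
          rw [Fintype.card_eq_zero_iff]; exact not_nonempty_iff.1 hne
        have h1 : 0 < k := by
          rcases Nat.eq_zero_or_pos k with h0 | h0
          · have := Fintype.card_pos (α := κ)
            rw [h0, mul_zero] at hL
            omega
          · exact h0
        have h2 : 0 < #W := by omega
        obtain ⟨w, _⟩ := card_pos.1 h2
        exact hne ⟨w⟩
  choose pick hpick using hpick
  let hm : V → Finset (V ⊕ κ) := fun w => IsAltPath.home M h (t w) (g w) (a w) (b w)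
  have hgC : ∀ w ∈ G, ∀ j ≤ t w, (g w j).1 ∈ C := fun w hw j hj =>
    hTC _ ((hpath w (hGW w hw)).mem j hj)
  -- z enters the home of a path through the edge of `M` at z (`S1`, at most 2 paths), as a path
  -- vertex (`S2`, at most 2), or through the home of a colour on the path (`S3`): at most s
  -- colours, 2B darts per colour and 2 paths per dart.
  have hcong : ∀ z, #(G.filter fun w => z ∈ hm w) ≤ 4 + 4 * B * s := by
    intro z
    let Fa : V → Finset V := fun v => G.filter fun w => ∃ j ≤ t w, a w j = v
    let Fb : V → Finset V := fun v => G.filter fun w => ∃ j ≤ t w, b w j = v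
    have hFa : ∀ v, #(Fa v) ≤ 1 := by
      intro v
      rw [Finset.card_le_one]
      intro w hw w' hw'
      obtain ⟨hw, j, hj, hv⟩ := mem_filter.1 hw
      obtain ⟨hw', j', hj', hv'⟩ := mem_filter.1 hw'
      exact ha w (hGW w hw) w' (hGW w' hw') j hj j' hj' (hv.trans hv'.symm)
    have hFb : ∀ v, #(Fb v) ≤ 1 := by
      intro v
      rw [Finset.card_le_one]
      intro w hw w' hw'
      obtain ⟨hw, j, hj, hv⟩ := mem_filter.1 hw
      obtain ⟨hw', j', hj', hv'⟩ := mem_filter.1 hw'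
      exact hb w (hGW w hw) w' (hGW w' hw') j hj j' hj' (hv.trans hv'.symm)
    let S1 : Finset V := (M.filter fun f => z ∈ edgeItems f).biUnion fun f => Fb f.2.1 ∪ Fb f.2.2
    let S2 : Finset V := Sum.elim (fun v => Fa v ∪ Fb v) (fun _ => ∅) z
    let S3 : Finset V := (C.filter fun c => z ∈ h c).biUnion fun c =>
      (T.filter fun x => x.1 = c).biUnion fun x => Fa x.2 ∪ Fb x.2
    have c1 : #S1 ≤ 2 := by
      refine (card_biUnion_le_card_mul _ _ 2 fun f _ => ?_).trans ?_
      · have := card_union_le (Fb f.2.1) (Fb f.2.2)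
        have := hFb f.2.1
        have := hFb f.2.2
        omega
      · have := IsAltPath.card_filter_mem_le_one hM z
        omega
    have c2 : #S2 ≤ 2 := by
      rcases z with v | c
      · have := card_union_le (Fa v) (Fb v)
        have := hFa v
        have := hFb v
        simp only [S2, Sum.elim_inl]
        omega
      · simp [S2]
    have c3 : #S3 ≤ s * (2 * B * 2) := by
      refine (card_biUnion_le_card_mul _ _ (2 * B * 2) fun c _ => ?_).trans
        (Nat.mul_le_mul_right _ (hst.congestion z))
      refine (card_biUnion_le_card_mul _ _ 2 fun x _ => ?_).trans
        (Nat.mul_le_mul_right _ (hcol c))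
      have := card_union_le (Fa x.2) (Fb x.2)
      have := hFa x.2
      have := hFb x.2
      omega
    have hsub : G.filter (fun w => z ∈ hm w) ⊆ (S1 ∪ S2) ∪ S3 := by
      intro w hw
      obtain ⟨hwG, hz⟩ := mem_filter.1 hw
      obtain ⟨j, hj, hz⟩ := mem_biUnion.1 hz
      have hj' : j ≤ t w := by have := mem_range.1 hj; omega
      have hbw : ∀ v, b w j = v → w ∈ Fb v := fun v hv => mem_filter.2 ⟨hwG, j, hj', hv⟩
      have haw : ∀ v, a w j = v → w ∈ Fa v := fun v hv => mem_filter.2 ⟨hwG, j, hj', hv⟩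
      rcases mem_union.1 hz with hz | hz
      · refine mem_union_left _ ?_
        rcases mem_union.1 hz with hz | hz
        · obtain ⟨f, hf, hzf⟩ := mem_biUnion.1 hz
          refine mem_union_left _ (mem_biUnion.2 ⟨f, mem_filter.2 ⟨(mem_filter.1 hf).1, hzf⟩, ?_⟩)
          rcases inl_mem_edgeItems.1 (mem_filter.1 hf).2 with h1 | h1
          · exact mem_union_left _ (hbw _ h1)
          · exact mem_union_right _ (hbw _ h1)
        · refine mem_union_right _ ?_
          simp only [mem_insert, mem_singleton] at hz
          rcases hz with rfl | rfl
          · exact mem_union_left _ (haw _ rfl)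
          · exact mem_union_right _ (hbw _ rfl)
      · refine mem_union_right _ (mem_biUnion.2 ⟨(g w j).1,
          mem_filter.2 ⟨hgC w hwG j hj', hz⟩, mem_biUnion.2 ⟨g w j,
          mem_filter.2 ⟨(hpath w (hGW w hwG)).mem j hj', rfl⟩, ?_⟩⟩)
        rcases (hpath w (hGW w hwG)).joins j hj' with ⟨h1, _⟩ | ⟨h1, _⟩
        · exact mem_union_left _ (haw _ h1.symm)
        · exact mem_union_right _ (hbw _ h1.symm)
    have c4 := card_le_card hsub
    have c5 := card_union_le (S1 ∪ S2) S3
    have c6 := card_union_le S1 S2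
    have c7 : s * (2 * B * 2) = 4 * B * s := by ring
    omega
  refine ⟨C ∪ Cn, fun c => if c ∈ C then h c else hm (pick c),
    fun c => if c ∈ C then sw c else swN (pick c), ⟨fun c hc => mem_union_left _ (hst.missing c hc),
      fun c hc => ?_, fun c hc => ?_, fun z => ?_⟩, ?_⟩
  · by_cases hcC : c ∈ C
    · simp only [hcC, if_true]
      exact hst.switch c hcC
    · simp only [hcC, if_false]
      have hcn : c ∈ Cn := (mem_union.1 hc).resolve_left hcC
      obtain ⟨h1, h2⟩ := hpick c hcn
      have := (hsw _ h1).2.2.2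
      rwa [h2] at this
  · by_cases hcC : c ∈ C
    · simp only [hcC, if_true]
      have := hst.card_home c hcC
      nlinarith
    · simp only [hcC, if_false]
      have hcn : c ∈ Cn := (mem_union.1 hc).resolve_left hcC
      obtain ⟨h1, h2⟩ := hpick c hcn
      refine (IsAltPath.card_home_le hM fun j hj =>
        hst.card_home _ (hgC _ h1 j hj)).trans (Nat.mul_le_mul_right _ ?_)
      have := not_le.1 (mem_filter.1 h1).2
      omega
  · have h1 : (C ∪ Cn).filter (fun c => z ∈ if c ∈ C then h c else hm (pick c)) ⊆
        C.filter (fun c => z ∈ h c) ∪ Cn.filter fun c => z ∈ hm (pick c) := by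
      intro c hc
      obtain ⟨h1, h2⟩ := mem_filter.1 hc
      by_cases hcC : c ∈ C
      · rw [if_pos hcC] at h2
        exact mem_union_left _ (mem_filter.2 ⟨hcC, h2⟩)
      · rw [if_neg hcC] at h2
        exact mem_union_right _ (mem_filter.2 ⟨(mem_union.1 h1).resolve_left hcC, h2⟩)
    have h2 : #(Cn.filter fun c => z ∈ hm (pick c)) ≤ #(G.filter fun w => z ∈ hm w) := by
      refine Finset.card_le_card_of_injOn pick ?_ ?_
      · intro c hc
        obtain ⟨h3, h4⟩ := mem_filter.1 hc
        exact mem_coe.2 (mem_filter.2 ⟨(hpick c h3).1, h4⟩)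
      · intro c hc c' hc' hcc
        rw [← (hpick c (mem_filter.1 hc).1).2, ← (hpick c' (mem_filter.1 hc').1).2, hcc]
    have h3 := (card_le_card h1).trans (card_union_le _ _)
    have h4 := hcong z
    have h5 := hst.congestion z
    omega
  · rw [card_union_of_disjoint hCnC]
    omega

end Stages

/-! ### The random sparsification of the darts. -/

section SparseDarts

open scoped Classical
open Finset

variable {V κ : Type*}

/-- Fix r in K. A colour has at most |K| - 1 darts inside K unless its dart at r stays in K. Such a
colour joins r to another vertex of K, and there are at most m(|K| - 1) such colours. -/
lemma card_darts_inside_le [Fintype κ] {E : κ → V → V → Prop} (hE : ∀ c v, ¬ E c v v) {m : ℕ}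
    (hm : ∀ u v, u ≠ v → #(univ.filter fun c => E c u v) ≤ m) {π : κ → Equiv.Perm V}
    {Ω : Finset (κ × V)} {C : Finset κ} (hΩC : ∀ g ∈ Ω, g.1 ∈ C)
    (hΩE : ∀ g ∈ Ω, E g.1 g.2 (π g.1 g.2)) (K : Finset V) (hK : K.Nonempty) :
    #(Ω.filter fun g => g.2 ∈ K ∧ π g.1 g.2 ∈ K) ≤ (#C + m) * (#K - 1) := by
  obtain ⟨r, hr⟩ := hK
  set F := Ω.filter fun g => g.2 ∈ K ∧ π g.1 g.2 ∈ K with hF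
  set Full : Finset κ := (K.erase r).biUnion fun y => univ.filter fun c => E c r y with hFull
  have h1 : #Full ≤ (#K - 1) * m := by
    refine (card_biUnion_le_card_mul _ _ m fun y hy => hm r y (Finset.ne_of_mem_erase hy).symm).trans
      ?_
    rw [Finset.card_erase_of_mem hr]
  have h2 : ∀ c ∈ C, #(F.filter fun g => g.1 = c) ≤ (#K - 1) + if c ∈ Full then 1 else 0 := by
    intro c hc
    have hinj : Set.InjOn Prod.snd (F.filter fun g => g.1 = c : Set (κ × V)) := by
      intro g hg g' hg' hgg
      exact Prod.ext ((mem_filter.1 hg).2.trans (mem_filter.1 hg').2.symm) hgg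
    by_cases hrF : (c, r) ∈ F
    · have hcF : c ∈ Full := by
        obtain ⟨h3, _, h4⟩ := mem_filter.1 hrF
        have h5 := hΩE _ h3
        refine mem_biUnion.2 ⟨π c r, mem_erase.2 ⟨fun h6 => ?_, h4⟩,
          mem_filter.2 ⟨mem_univ _, h5⟩⟩
        simp only at h5
        rw [h6] at h5
        exact hE _ _ h5
      rw [if_pos hcF, Nat.sub_add_cancel (card_pos.2 ⟨r, hr⟩)]
      refine Finset.card_le_card_of_injOn Prod.snd ?_ hinj
      intro g hg
      exact (mem_filter.1 (mem_filter.1 hg).1).2.1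
    · refine le_trans ?_ (Nat.le_add_right _ _)
      rw [← Finset.card_erase_of_mem hr]
      refine Finset.card_le_card_of_injOn Prod.snd ?_ hinj
      intro g hg
      refine mem_coe.2 (mem_erase.2 ⟨?_, (mem_filter.1 (mem_filter.1 hg).1).2.1⟩)
      rintro rfl
      obtain ⟨h3, h4⟩ := mem_filter.1 hg
      subst h4
      exact hrF h3
  have h3 : #F = ∑ c ∈ C, #(F.filter fun g => g.1 = c) :=
    Finset.card_eq_sum_card_fiberwise fun g hg => hΩC g (mem_filter.1 hg).1
  rw [h3]
  refine (Finset.sum_le_sum h2).trans ?_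
  rw [Finset.sum_add_distrib, Finset.sum_const, smul_eq_mul, Finset.sum_boole, Nat.add_mul]
  refine Nat.add_le_add_left ?_ _
  rw [mul_comm m]
  refine le_trans ?_ h1
  simp only [Nat.cast_id]
  exact card_le_card fun c hc => (mem_filter.1 hc).2

/-- For |K| ≥ 2 one has 2(|K| - 1) ≥ |K|, so the sum is at most (1 + w)^|R| - 1. -/
lemma sum_powerset_pow_le {A : Type*} (R : Finset A) {y w : ℝ} (hw : 0 ≤ w) (hw1 : w ≤ 1)
    (hy : y = w ^ 2) (hR : w * #R ≤ 1) :
    ∑ K ∈ R.powerset.filter (fun K => 2 ≤ #K), y ^ (#K - 1) ≤ 2 * (w * #R) := by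
  have h1 : ∑ K ∈ R.powerset.filter (fun K => 2 ≤ #K), y ^ (#K - 1) ≤
      ∑ K ∈ R.powerset.erase ∅, w ^ #K := by
    refine (Finset.sum_le_sum (g := fun K => w ^ #K) fun K hK => ?_).trans
      (Finset.sum_le_sum_of_subset_of_nonneg ?_ fun K _ _ => by positivity)
    · rw [hy, ← pow_mul]
      have := (mem_filter.1 hK).2
      exact pow_le_pow_of_le_one hw hw1 (by omega)
    · intro K hK
      obtain ⟨h2, h3⟩ := mem_filter.1 hK
      refine mem_erase.2 ⟨?_, h2⟩
      rintro rfl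
      simp at h3
  have h2 : ∑ K ∈ R.powerset.erase ∅, w ^ #K = (w + 1) ^ #R - 1 := by
    have h3 := Finset.sum_pow_mul_eq_add_pow w 1 R
    simp only [one_pow, mul_one] at h3
    rw [← h3, ← Finset.sum_erase_add _ _ (Finset.empty_mem_powerset R)]
    simp
  rw [h2] at h1
  have h3 : (w + 1) ^ #R ≤ Real.exp (w * #R) := by
    rw [mul_comm, Real.exp_nat_mul]
    exact pow_le_pow_left₀ (by linarith) (Real.add_one_le_exp w) _
  have h0 : 0 ≤ w * #R := by positivity
  have h4 := Real.abs_exp_sub_one_sub_id_le (x := w * #R) (by rw [abs_of_nonneg h0]; exact hR)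
  have h5 := (abs_le.1 h4).2
  nlinarith

lemma exp_neg_mul_sq_le {n X : ℕ} (hX : 1 ≤ X) (hn : (n : ℝ) ≤ Real.exp ((X : ℝ) ^ 2)) :
    Real.exp (-(50 * (X : ℝ) ^ 2)) * (8 * n ^ 2) ≤ 1 / 32 := by
  have hX1 : (1 : ℝ) ≤ (X : ℝ) ^ 2 := by
    have : (1 : ℝ) ≤ X := by exact_mod_cast hX
    nlinarith
  have h1 : (n : ℝ) ^ 2 ≤ Real.exp (2 * (X : ℝ) ^ 2) := by
    calc (n : ℝ) ^ 2 ≤ Real.exp ((X : ℝ) ^ 2) ^ 2 := by gcongr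
      _ = _ := by rw [← Real.exp_nat_mul]; norm_num
  have h2 : Real.exp (-(50 * (X : ℝ) ^ 2)) * (8 * n ^ 2) ≤
      8 * Real.exp (-(48 * (X : ℝ) ^ 2)) := by
    calc _ ≤ Real.exp (-(50 * (X : ℝ) ^ 2)) * (8 * Real.exp (2 * (X : ℝ) ^ 2)) := by gcongr
      _ = 8 * (Real.exp (-(50 * (X : ℝ) ^ 2)) * Real.exp (2 * (X : ℝ) ^ 2)) := by ring
      _ = _ := by rw [← Real.exp_add]; ring_nf
  have h3 : Real.exp (-(48 * (X : ℝ) ^ 2)) ≤ Real.exp (-48) := Real.exp_le_exp.2 (by linarith)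
  have h4 : Real.exp (-48) ≤ 1 / 256 := by
    rw [Real.exp_neg, one_div]
    refine inv_anti₀ (by norm_num) ?_
    have h5 : Real.exp 48 = Real.exp 1 ^ 48 := by rw [← Real.exp_nat_mul]; norm_num
    rw [h5]
    have h6 : (2 : ℝ) ≤ Real.exp 1 := by have := Real.add_one_le_exp 1; linarith
    calc (256 : ℝ) ≤ 2 ^ 48 := by norm_num
      _ ≤ _ := by gcongr
  linarith

/-- The union bound over starts, ends, colours and vertex sets. The second component of a pair is
its allowance in units of β, and log n ≤ X² lets the exponent 100X² beat the number of choices. -/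
lemma sum_exp_families_le {A D : Type*} {R : Finset V} {C : Finset D} {n X : ℕ} (hX : 1 ≤ X)
    (hn1 : 1 ≤ n) (hn : (n : ℝ) ≤ Real.exp ((X : ℝ) ^ 2)) (hR : #R ≤ 8 * n ^ 2) (hC : #C ≤ n)
    (K1 K2 : V → A) (K3 : D → A) (K4 : Finset V → A) :
    ∑ x ∈ ((R.image fun v => (K1 v, 1)) ∪ R.image fun v => (K2 v, 1)) ∪
      ((C.image fun c => (K3 c, 2)) ∪
        (R.powerset.filter fun K => 2 ≤ #K).image fun K => (K4 K, #K - 1)),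
      Real.exp (-(100 * (X : ℝ) ^ 2 * x.2)) ≤ 1 / 4 := by
  set w : ℝ := Real.exp (-(50 * (X : ℝ) ^ 2)) with hw
  have hw0 : 0 ≤ w := (Real.exp_pos _).le
  have hw1 : w ≤ 1 := Real.exp_le_one_iff.2 (by rw [Left.neg_nonpos_iff]; positivity)
  have hwn : w * (8 * n ^ 2) ≤ 1 / 32 := exp_neg_mul_sq_le hX hn
  have hbound : ∀ j : ℕ, j ≤ 8 * n ^ 2 → w * (j : ℝ) ≤ 1 / 32 := by
    intro j hj
    have h1 : (j : ℝ) ≤ 8 * n ^ 2 := by exact_mod_cast hj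
    exact (mul_le_mul_of_nonneg_left h1 hw0).trans hwn
  have hwR := hbound _ hR
  have hwC := hbound _ (hC.trans (by nlinarith : n ≤ 8 * n ^ 2))
  have hpow : ∀ j : ℕ, Real.exp (-(100 * (X : ℝ) ^ 2 * j)) = (w ^ 2) ^ j := by
    intro j
    rw [hw, ← Real.exp_nat_mul, ← Real.exp_nat_mul]
    congr 1
    push_cast
    ring
  have hww : w ^ 2 ≤ w := pow_le_of_le_one hw0 hw1 two_ne_zero
  have hww2 : (w ^ 2) ^ 2 ≤ w := by
    rw [← pow_mul]
    exact pow_le_of_le_one hw0 hw1 (by norm_num)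
  have hpos : ∀ x : A × ℕ, 0 ≤ Real.exp (-(100 * (X : ℝ) ^ 2 * x.2)) :=
    fun x => (Real.exp_pos _).le
  have hun : ∀ s t : Finset (A × ℕ), ∑ x ∈ s ∪ t, Real.exp (-(100 * (X : ℝ) ^ 2 * x.2)) ≤
      ∑ x ∈ s, Real.exp (-(100 * (X : ℝ) ^ 2 * x.2)) +
        ∑ x ∈ t, Real.exp (-(100 * (X : ℝ) ^ 2 * x.2)) := by
    intro s t
    rw [← Finset.sum_union_inter]
    exact le_add_of_nonneg_right (Finset.sum_nonneg fun l _ => hpos l)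
  have s1 : ∀ K1 : V → A, ∑ x ∈ R.image (fun v => (K1 v, (1 : ℕ))),
      Real.exp (-(100 * (X : ℝ) ^ 2 * x.2)) ≤ w * #R := by
    intro K1
    refine (Finset.sum_image_le_of_nonneg fun x _ => hpos _).trans ?_
    simp only [hpow, pow_one]
    rw [Finset.sum_const, nsmul_eq_mul, mul_comm]
    exact mul_le_mul_of_nonneg_right hww (Nat.cast_nonneg _)
  have s3 : ∑ x ∈ C.image (fun c => (K3 c, (2 : ℕ))), Real.exp (-(100 * (X : ℝ) ^ 2 * x.2)) ≤
      w * #C := by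
    refine (Finset.sum_image_le_of_nonneg fun x _ => hpos _).trans ?_
    simp only [hpow]
    rw [Finset.sum_const, nsmul_eq_mul, mul_comm]
    exact mul_le_mul_of_nonneg_right hww2 (Nat.cast_nonneg _)
  have s4 : ∑ x ∈ (R.powerset.filter fun K => 2 ≤ #K).image (fun K => (K4 K, #K - 1)),
      Real.exp (-(100 * (X : ℝ) ^ 2 * x.2)) ≤ 2 * (w * #R) := by
    refine (Finset.sum_image_le_of_nonneg fun x _ => hpos _).trans ?_
    simp only [hpow]
    exact sum_powerset_pow_le R hw0 hw1 rfl (by linarith)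
  have := hun ((R.image fun v => (K1 v, 1)) ∪ R.image fun v => (K2 v, 1))
    ((C.image fun c => (K3 c, 2)) ∪
      (R.powerset.filter fun K => 2 ≤ #K).image fun K => (K4 K, #K - 1))
  have := hun (R.image fun v => (K1 v, 1)) (R.image fun v => (K2 v, 1))
  have := hun (C.image fun c => (K3 c, 2))
    ((R.powerset.filter fun K => 2 ≤ #K).image fun K => (K4 K, #K - 1))
  have := s1 K1
  have := s1 K2
  linarith

lemma exp_neg_mul_le {X j : ℕ} (hX : 1 ≤ X) (hj : 1 ≤ j) :
    Real.exp (-(200 * (X : ℝ) ^ 2 * j)) ≤ 1 / 4 := by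
  have h0 : (1 : ℝ) ≤ (X : ℝ) ^ 2 * j := by
    have : 1 ≤ X ^ 2 * j := Nat.mul_pos (pow_pos hX 2) hj
    exact_mod_cast this
  have h1 : Real.exp (-(200 * (X : ℝ) ^ 2 * j)) ≤ Real.exp (-200) :=
    Real.exp_le_exp.2 (by linarith)
  have h2 : Real.exp (-200) ≤ 1 / 4 := by
    rw [Real.exp_neg, one_div]
    refine inv_anti₀ (by norm_num) ?_
    have := Real.add_one_le_exp 200
    linarith
  exact h1.trans h2

/-- Sampling loses 3δ in the size of T and 2δ in B, in total 10τδc. Since δc ≤ k/100, the term τk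
absorbs this. -/
lemma mul_count_le {t τ δ x N c k : ℝ} (hx : 0 < x) (hδ : δ = 1 / x) (hτ : 0 ≤ τ)
    (hkx : 100 * N ≤ x * k) (hc : c ≤ N) (hk : 4 ≤ k) (ht : (1 - 3 * δ) * (2 * τ * c) ≤ t) :
    τ * (1 + 2 * δ) * (2 * c + 2) ≤ t + τ * (1 + 2 * δ) * k := by
  have hδ0 : 0 < δ := by rw [hδ]; positivity
  have e4 : δ * c ≤ k / 100 := by
    rw [hδ, div_mul_eq_mul_div, one_mul, div_le_iff₀ hx]
    linarith
  have e5 : 0 ≤ τ * δ * (k - 2) := by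
    have : (0 : ℝ) ≤ k - 2 := by linarith
    positivity
  have e6 : τ * (10 * (δ * c) + 2) ≤ τ * k := by
    refine mul_le_mul_of_nonneg_left ?_ hτ
    linarith
  have e7 : 0 ≤ τ * (k / 100 - δ * c) := mul_nonneg hτ (by linarith)
  have e8 : 0 ≤ τ * k := mul_nonneg hτ (by linarith)
  nlinarith

variable [Fintype V] [Fintype κ]

set_option maxHeartbeats 1000000 in
/-- The random sparsification: there is a sparse set of darts to which `IsStage.exists_next`
applies. -/
theorem IsStage.exists_sparse_darts {E : κ → V → V → Prop} {M : Finset (κ × V × V)} {ℓ s : ℕ}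
    {C : Finset κ} {h : κ → Finset (V ⊕ κ)} {sw : κ → Finset (κ × V × V)}
    (hst : IsStage E M ℓ s C h sw) (hE : ∀ c v, ¬ E c v v) (hM : IsRainbowFinset E M) {m : ℕ}
    (hm : ∀ u v, u ≠ v → #(univ.filter fun c => E c u v) ≤ m) (hmn : m ≤ Fintype.card κ)
    {π : κ → Equiv.Perm V} {S : κ → Finset V} (hπ : ∀ c, ∀ v ∈ S c, E c v (π c v))
    (hS : ∀ c, 2 * Fintype.card κ + 2 * m ≤ #(S c))
    {k X : ℕ} (hk : #M + k = Fintype.card κ) (hX : 1 ≤ X) (hk4 : 4 ≤ k)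
    (hkX : 100 * Fintype.card κ ≤ X * k)
    (hnX : (Fintype.card κ : ℝ) ≤ Real.exp ((X : ℝ) ^ 2)) (hℓ : 1 ≤ ℓ) (hs : 1 ≤ s)
    (hnum : 2400 * X ^ 5 * (X + 1) * (200 * X ^ 4) ^ X * (ℓ * s) ≤ k) :
    ∃ T : Finset (κ × V), (∀ g ∈ T, g.1 ∈ C) ∧ (∀ g ∈ T, E g.1 g.2 (π g.1 g.2)) ∧
      (∀ g ∈ T, g.2 ∉ outVerts M C) ∧
      (∀ v, #(T.filter fun g => g.2 = v) ≤ 100 * X ^ 4 + 200 * X ^ 3) ∧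
      (∀ v, #(T.filter fun g => π g.1 g.2 = v) ≤ 100 * X ^ 4 + 200 * X ^ 3) ∧
      (∀ K : Finset V, K.Nonempty → Disjoint K (outVerts M C) →
        #(T.filter fun g => g.2 ∈ K ∧ π g.1 g.2 ∈ K) ≤
          (100 * X ^ 4 + 200 * X ^ 3) * (#K - 1)) ∧
      (∀ c, #(T.filter fun g => g.1 = c) ≤ 2 * (100 * X ^ 4 + 200 * X ^ 3)) ∧
      (100 * X ^ 4 + 200 * X ^ 3) * (2 * #C + 2) ≤ #T + (100 * X ^ 4 + 200 * X ^ 3) * k ∧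
      (∀ r ≤ X, ∀ g a b,
        (IsDartWalk π T (partner M) r g a b →
          ∀ z, a 0 = z ∨ a 0 = partner M z → Sum.inl z ∉ h (g r).1) ∧
        (IsDartWalk π T (partner M) (r + 1) g a b →
          Disjoint (h (g 0).1) (h (g (r + 1)).1))) := by
  set n := Fintype.card κ with hn
  set β := #C + m with hβ
  have hOutcard := card_outVerts hM hE hst.missing
  have hCn : #C ≤ n := card_le_univ C
  have hCk : k ≤ #C := by
    have h1 : (M.image Prod.fst)ᶜ ⊆ C := by
      intro c hc
      refine hst.missing c fun e he hec => mem_compl.1 hc (mem_image.2 ⟨e, he, hec⟩)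
    have h2 := card_le_card h1
    have h3 := card_compl_add_card (M.image Prod.fst)
    rw [card_image_of_injOn hM.injOn_colour] at h3
    omega
  -- the darts
  have hS' : ∀ c, ∃ S' ⊆ S c \ outVerts M C, #S' = 2 * β := by
    intro c
    -- Removing the 2(n - |C|) vertices of Out from at least 2n + 2m leaves at least 2|C| + 2m = 2β.
    refine Finset.exists_subset_card_eq ?_
    have h1 := Finset.le_card_sdiff (outVerts M C) (S c)
    have h2 := hS c
    omega
  choose S' hS'sub hS'card using hS'
  set Ω : Finset (κ × V) := C.biUnion fun c => (S' c).image (Prod.mk c) with hΩ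
  have hΩm : ∀ g ∈ Ω, g.1 ∈ C ∧ g.2 ∈ S' g.1 := by
    intro g hg
    obtain ⟨c, hc, hg⟩ := mem_biUnion.1 hg
    obtain ⟨v, hv, rfl⟩ := mem_image.1 hg
    exact ⟨hc, hv⟩
  have hΩC : ∀ g ∈ Ω, g.1 ∈ C := fun g hg => (hΩm g hg).1
  have hΩE : ∀ g ∈ Ω, E g.1 g.2 (π g.1 g.2) := fun g hg =>
    hπ _ _ (mem_sdiff.1 (hS'sub _ (hΩm g hg).2)).1
  have hΩout : ∀ g ∈ Ω, g.2 ∉ outVerts M C := fun g hg =>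
    (mem_sdiff.1 (hS'sub _ (hΩm g hg).2)).2
  have hΩne : ∀ g ∈ Ω, π g.1 g.2 ≠ g.2 := fun g hg heq => by
    have := hΩE g hg
    rw [heq] at this
    exact hE _ _ this
  have hΩcard : #Ω = #C * (2 * β) := by
    rw [hΩ, card_biUnion, Finset.sum_const_nat (m := 2 * β)]
    · intro c _
      rw [card_image_of_injective _ (Prod.mk_right_injective c), hS'card]
    · intro c _ d _ hcd
      refine Finset.disjoint_left.2 fun g hg hg' => hcd ?_
      obtain ⟨v, _, rfl⟩ := mem_image.1 hg
      obtain ⟨v', _, h2⟩ := mem_image.1 hg'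
      exact (congrArg Prod.fst h2).symm
  -- the real parameters
  have hC0 : 0 < #C := by omega
  have hβ0 : 0 < β := by omega
  have hXr : (1 : ℝ) ≤ X := by exact_mod_cast hX
  have hCr : (0 : ℝ) < #C := by exact_mod_cast hC0
  have hβr : (0 : ℝ) < β := by exact_mod_cast hβ0
  -- With δ = 1/X the deviation exponent is δ²τ = 100X², and B = τ(1 + 2δ) is the integer 100X⁴ +
  -- 200X³.
  set τ : ℝ := 100 * (X : ℝ) ^ 4 with hτ
  have hτ1 : 1 ≤ τ := by
    have := one_le_pow₀ (n := 4) hXr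
    linarith
  set δ : ℝ := 1 / X with hδ
  have hδ0 : 0 < δ := by positivity
  have hδ1 : δ ≤ 1 := by rw [hδ, div_le_one (by linarith)]; exact hXr
  have hBr : τ * (1 + 2 * δ) = ((100 * X ^ 4 + 200 * X ^ 3 : ℕ) : ℝ) := by
    rw [hτ, hδ]
    push_cast
    field_simp
    ring
  have hδτ : δ ^ 2 * τ = 100 * (X : ℝ) ^ 2 := by
    rw [hτ, hδ]; field_simp
  have hnumr : 2400 * (X : ℝ) ^ 5 * (X + 1) * (200 * (X : ℝ) ^ 4) ^ X * (ℓ * s) ≤ β := by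
    have : 2400 * X ^ 5 * (X + 1) * (200 * X ^ 4) ^ X * (ℓ * s) ≤ β := hnum.trans (by omega)
    exact_mod_cast this
  -- A family with at most βj darts then has at most τj sampled darts in expectation.
  set p : ℝ := τ / β with hp
  have hp0 : 0 < p := by positivity
  have hpβ : p * β = τ := by rw [hp]; field_simp
  have hτβ : τ ≤ β := by
    have h1 : 100 * X ^ 4 ≤ 2400 * X ^ 5 * (X + 1) * (200 * X ^ 4) ^ X * (ℓ * s) := by
      have e1 : 1 ≤ (200 * X ^ 4) ^ X := Nat.one_le_pow _ _ (by positivity)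
      have e2 : 1 ≤ ℓ * s := Nat.mul_pos hℓ hs
      calc 100 * X ^ 4 ≤ 2400 * (X ^ 4 * X) * (1 + 1) * 1 * 1 := by nlinarith [Nat.zero_le (X ^ 4)]
        _ = 2400 * X ^ 5 * (1 + 1) * 1 * 1 := by ring
        _ ≤ _ := by gcongr
    have h2 : 100 * X ^ 4 ≤ β := h1.trans (hnum.trans (by omega))
    rw [hτ]
    exact_mod_cast h2
  have hp1 : p ≤ 1 := by rw [hp, div_le_one hβr]; exact hτβ
  have hpΩ : p * #Ω = 2 * τ * #C := by
    rw [hΩcard]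
    push_cast
    linear_combination (2 * #C : ℝ) * hpβ
  have hfrac : ∀ (F : Finset (κ × V)) (j : ℕ), #F ≤ β * j → p * #F ≤ τ * j := by
    intro F j hF
    have h1 : (#F : ℝ) ≤ β * j := by exact_mod_cast hF
    calc p * #F ≤ p * (β * j) := by gcongr
      _ = τ * j := by rw [← mul_assoc, hpβ]
  -- the vertices that are incident to darts
  set R : Finset V := Ω.image Prod.snd ∪ Ω.image fun g => π g.1 g.2 with hR
  have hRcard : #R ≤ 8 * n ^ 2 := by
    have h2 := card_image_le (s := Ω) (f := Prod.snd)
    have h3 := card_image_le (s := Ω) (f := fun g => π g.1 g.2)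
    have h4 : β ≤ 2 * n := by omega
    calc #R ≤ #(Ω.image Prod.snd) + #(Ω.image fun g => π g.1 g.2) := card_union_le _ _
      _ ≤ #Ω + #Ω := Nat.add_le_add h2 h3
      _ ≤ n * (2 * (2 * n)) + n * (2 * (2 * n)) := by rw [hΩcard]; gcongr
      _ = _ := by ring
  obtain ⟨𝓑, h𝓑1, h𝓑2, h𝓑3⟩ := exists_conflict_family (Mq := partner M) hΩC hΩne h hst.card_home
    hst.congestion X hp0 hτ1
    (by
      calc (#C : ℝ) * p ≤ β * p := by
            gcongr
            rw [hβ]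
            omega
        _ = τ := by rw [mul_comm, hpβ])
    (by rw [mul_comm, hpΩ])
  let K1 : V → Finset (κ × V) := fun v => Ω.filter fun g => g.2 = v
  let K2 : V → Finset (κ × V) := fun v => Ω.filter fun g => π g.1 g.2 = v
  let K3 : κ → Finset (κ × V) := fun c => Ω.filter fun g => g.1 = c
  let K4 : Finset V → Finset (κ × V) := fun K => Ω.filter fun g => g.2 ∈ K ∧ π g.1 g.2 ∈ K
  have hK1 : ∀ v, #(K1 v) ≤ β * 1 := by
    intro v
    have : #(K1 v) ≤ #C := by
      refine Finset.card_le_card_of_injOn Prod.fst (fun g hg => hΩC g (mem_filter.1 hg).1) ?_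
      intro g hg g' hg' hgg
      exact Prod.ext hgg ((mem_filter.1 hg).2.trans (mem_filter.1 hg').2.symm)
    omega
  have hK2 : ∀ v, #(K2 v) ≤ β * 1 := by
    intro v
    have : #(K2 v) ≤ #C := by
      refine Finset.card_le_card_of_injOn Prod.fst (fun g hg => hΩC g (mem_filter.1 hg).1) ?_
      intro g hg g' hg' hgg
      have h1 := (mem_filter.1 hg).2.trans (mem_filter.1 hg').2.symm
      rw [hgg] at h1
      exact Prod.ext hgg ((π _).injective h1)
    omega
  have hK3 : ∀ c, #(K3 c) ≤ β * 2 := by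
    intro c
    have : #(K3 c) ≤ #(S' c) := by
      refine Finset.card_le_card_of_injOn Prod.snd ?_ ?_
      · intro g hg
        have := (hΩm g (mem_filter.1 hg).1).2
        rwa [(mem_filter.1 hg).2] at this
      · intro g hg g' hg' hgg
        exact Prod.ext ((mem_filter.1 hg).2.trans (mem_filter.1 hg').2.symm) hgg
    rw [hS'card] at this
    omega
  set 𝓕 : Finset (Finset (κ × V) × ℕ) := ((R.image fun v => (K1 v, 1)) ∪
    R.image fun v => (K2 v, 1)) ∪ ((C.image fun c => (K3 c, 2)) ∪
      (R.powerset.filter fun K => 2 ≤ #K).image fun K => (K4 K, #K - 1)) with h𝓕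
  have h𝓕1 : ∀ x ∈ 𝓕, x.1 ⊆ Ω ∧ p * #x.1 ≤ τ * x.2 := by
    intro x hx
    simp only [h𝓕, mem_union, mem_image] at hx
    rcases hx with (⟨v, _, rfl⟩ | ⟨v, _, rfl⟩) | ⟨c, _, rfl⟩ | ⟨K, hK, rfl⟩
    · exact ⟨filter_subset _ _, hfrac _ _ (hK1 v)⟩
    · exact ⟨filter_subset _ _, hfrac _ _ (hK2 v)⟩
    · exact ⟨filter_subset _ _, hfrac _ _ (hK3 c)⟩
    · refine ⟨filter_subset _ _, hfrac _ _ ?_⟩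
      have h1 := (mem_filter.1 hK).2
      exact card_darts_inside_le hE hm hΩC hΩE K (card_pos.1 (by omega))
  have h𝓕2 : ∑ x ∈ 𝓕, Real.exp (-(δ ^ 2 * τ * x.2)) ≤ 1 / 4 := by
    simp only [hδτ]
    convert sum_exp_families_le hX (by omega) hnX hRcard hCn K1 K2 K3 K4
  obtain ⟨T, hTΩ, hT1, hT2, hT3⟩ := exists_sample hp0 hp1 hδ0 hδ1
    (card_pos.1 (by rw [hΩcard]; positivity)) 𝓕 h𝓕1 h𝓕2
    (by
      rw [hpΩ, show δ ^ 2 * (2 * τ * #C) = 200 * (X : ℝ) ^ 2 * #C by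
        linear_combination (2 * #C : ℝ) * hδτ]
      exact exp_neg_mul_le hX hC0)
    𝓑 h𝓑1
    (by
      refine h𝓑2.trans ?_
      rw [hpΩ]
      have h1 : 2 * τ = 200 * (X : ℝ) ^ 4 := by rw [hτ]; ring
      rw [h1]
      have h2 : 1 / 4 * (δ * (200 * (X : ℝ) ^ 4 * #C)) = 50 * (X : ℝ) ^ 3 * #C := by
        rw [hδ]; field_simp; ring
      rw [h2]
      have h3 : ((X : ℝ) + 1) * (200 * (X : ℝ) ^ 4) ^ X * (12 * ℓ * s * #C * p * τ) * β =
          (2400 * (X : ℝ) ^ 5 * (X + 1) * (200 * (X : ℝ) ^ 4) ^ X * (ℓ * s)) *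
            (50 * (X : ℝ) ^ 3 * #C) := by
        calc _ = ((X : ℝ) + 1) * (200 * (X : ℝ) ^ 4) ^ X * (12 * ℓ * s * #C * τ) * (p * β) := by
              ring
          _ = _ := by rw [hpβ, hτ]; ring
      refine le_of_mul_le_mul_right ?_ hβr
      rw [h3, mul_comm _ (β : ℝ)]
      gcongr)
  have hcast : ∀ (q : κ × V → Prop) [DecidablePred q] (j : ℕ), (Ω.filter q, j) ∈ 𝓕 →
      #(T.filter q) ≤ (100 * X ^ 4 + 200 * X ^ 3) * j := by
    intro q _ j hFj
    have h1 : (#(T ∩ Ω.filter q) : ℝ) ≤ τ * (1 + 2 * δ) * j := by convert hT1 _ hFj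
    rw [hBr] at h1
    have h2 : T.filter q ⊆ T ∩ Ω.filter q := fun g hg =>
      mem_inter.2 ⟨(mem_filter.1 hg).1, mem_filter.2 ⟨hTΩ (mem_filter.1 hg).1, (mem_filter.1 hg).2⟩⟩
    have h3 := (Nat.cast_le.2 (card_le_card h2)).trans h1
    exact_mod_cast h3
  refine ⟨T, fun g hg => hΩC g (hTΩ hg), fun g hg => hΩE g (hTΩ hg), fun g hg =>
    hΩout g (hTΩ hg), fun v => ?_, fun v => ?_, fun K _ _ => ?_, fun c => ?_, ?_, ?_⟩
  · by_cases hv : v ∈ R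
    · have h1 := hcast (fun g => g.2 = v) 1 (mem_union_left _ (mem_union_left _ (mem_image.2 ⟨v, hv, rfl⟩)))
      rwa [mul_one] at h1
    · rw [Finset.filter_false_of_mem, card_empty]
      · exact Nat.zero_le _
      · rintro g hg rfl
        exact hv (mem_union_left _ (mem_image_of_mem _ (hTΩ hg)))
  · by_cases hv : v ∈ R
    · have h1 := hcast (fun g => π g.1 g.2 = v) 1 (mem_union_left _ (mem_union_right _ (mem_image.2 ⟨v, hv, rfl⟩)))
      rwa [mul_one] at h1
    · rw [Finset.filter_false_of_mem, card_empty]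
      · exact Nat.zero_le _
      · rintro g hg rfl
        exact hv (mem_union_right _ (mem_image_of_mem _ (hTΩ hg)))
  -- V may be huge, so K is first cut down to the at most 8n² vertices that meet darts; the union
  -- bound runs over subsets of `R` only.
  · have h0 : T.filter (fun g => g.2 ∈ K ∧ π g.1 g.2 ∈ K) ⊆
        T.filter (fun g => g.2 ∈ K ∩ R ∧ π g.1 g.2 ∈ K ∩ R) := by
      intro g hg
      obtain ⟨h1, h2, h3⟩ := mem_filter.1 hg
      exact mem_filter.2 ⟨h1, mem_inter.2 ⟨h2, mem_union_left _ (mem_image_of_mem _ (hTΩ h1))⟩,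
        mem_inter.2 ⟨h3, mem_union_right _ (mem_image.2 ⟨g, hTΩ h1, rfl⟩)⟩⟩
    refine (card_le_card h0).trans ?_
    by_cases h2 : 2 ≤ #(K ∩ R)
    · have h1 := hcast
        (fun g => g.2 ∈ K ∩ R ∧ π g.1 g.2 ∈ K ∩ R) (#(K ∩ R) - 1) (mem_union_right _ (mem_union_right _
        (mem_image.2 ⟨K ∩ R, mem_filter.2 ⟨mem_powerset.2 inter_subset_right, h2⟩, rfl⟩)))
      refine h1.trans (Nat.mul_le_mul_left _ ?_)
      have := card_le_card (inter_subset_left (s₁ := K) (s₂ := R))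
      omega
    · rw [Finset.filter_false_of_mem, card_empty]
      · exact Nat.zero_le _
      · rintro g hg ⟨h3, h4⟩
        refine h2 ?_
        exact Finset.one_lt_card.2 ⟨_, h3, _, h4, (hΩne g (hTΩ hg)).symm⟩
  · by_cases hc : c ∈ C
    · have h1 := hcast (fun g => g.1 = c) 2 (mem_union_right _ (mem_union_left _ (mem_image.2 ⟨c, hc, rfl⟩)))
      rwa [mul_comm] at h1
    · rw [Finset.filter_false_of_mem, card_empty]
      · exact Nat.zero_le _
      · rintro g hg rfl
        exact hc (hΩC g (hTΩ hg))
  · rw [hpΩ] at hT2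
    have h1 : ((100 * X ^ 4 + 200 * X ^ 3 : ℕ) : ℝ) * (2 * #C + 2) ≤
        #T + ((100 * X ^ 4 + 200 * X ^ 3 : ℕ) : ℝ) * k := by
      rw [← hBr]
      exact mul_count_le (N := n) (by linarith) hδ (by linarith) (by exact_mod_cast hkX)
        (by exact_mod_cast hCn) (by exact_mod_cast hk4) hT2
    exact_mod_cast h1
  · intro r hr g a b
    exact h𝓑3 T hTΩ hT3 r hr g a b

end SparseDarts

/-! ### Iterating the stages and choosing the parameters. -/

section RainbowFinsets

open scoped Classical
open Finset Filter

variable {V κ : Type*} [Fintype V] [Fintype κ]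

/-- A missing colour is free already: `M` itself is the switch and the home is just the colour. -/
lemma isStage_missing {E : κ → V → V → Prop} {M : Finset (κ × V × V)} (hM : IsRainbowFinset E M) :
    IsStage E M 1 1 (univ.filter fun c => ∀ e ∈ M, e.1 ≠ c) (fun c => {Sum.inr c})
      (fun _ => M) where
  missing c hc := mem_filter.2 ⟨mem_univ c, hc⟩
  switch c hc := ⟨hM, le_rfl, (mem_filter.1 hc).2, fun e h1 h2 => absurd h1 h2,
    fun e h1 h2 => absurd h1 h2, mem_singleton_self _⟩
  card_home c _ := by simp
  congestion z := by
    refine Finset.card_le_one.2 fun c hc d hd => ?_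
    have h1 := mem_singleton.1 (mem_filter.1 hc).2
    have h2 := mem_singleton.1 (mem_filter.1 hd).2
    exact Sum.inr.inj (h1.symm.trans h2)

/-- Otherwise X rounds are possible and give 4|C| ≥ Xk ≥ 100n, although there are only n colours.
`hnum` is the sparsification condition at the largest ℓ and s that can arise. -/
lemma card_add_le_of_isMaximum {E : κ → V → V → Prop} (hEs : ∀ c u v, E c u v → E c v u)
    (hE : ∀ c v, ¬ E c v v) {M : Finset (κ × V × V)} (hM : IsRainbowFinset E M)
    (hmax : ∀ X, IsRainbowFinset E X → #X ≤ #M) {m : ℕ}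
    (hm : ∀ u v, u ≠ v → #(univ.filter fun c => E c u v) ≤ m) (hmn : m ≤ Fintype.card κ)
    {π : κ → Equiv.Perm V} {S : κ → Finset V} (hπ : ∀ c, ∀ v ∈ S c, E c v (π c v))
    (hS : ∀ c, 2 * Fintype.card κ + 2 * m ≤ #(S c))
    {k X : ℕ} (hk : #M + k = Fintype.card κ) (hX : 1 ≤ X) (hk4 : 4 ≤ k)
    (hnX : (Fintype.card κ : ℝ) ≤ Real.exp ((X : ℝ) ^ 2))
    (hnum : 2400 * X ^ 5 * (X + 1) * (200 * X ^ 4) ^ X *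
      ((12 * X) ^ X * (2700 * X ^ 4) ^ X) ≤ k) :
    X * k < 100 * Fintype.card κ := by
  by_contra! hkX
  have hκ : Nonempty κ := Fintype.card_pos_iff.1 (by omega)
  have hiter : ∀ i ≤ X, ∃ ℓ s C h sw, IsStage E M ℓ s C h sw ∧ 1 ≤ ℓ ∧ 1 ≤ s ∧
      ℓ ≤ (12 * X) ^ i ∧ s ≤ (2700 * X ^ 4) ^ i ∧ i * k ≤ 4 * #C := by
    intro i
    induction i with
    | zero =>
      intro _
      exact ⟨1, 1, _, _, _, isStage_missing hM, le_rfl, le_rfl, by simp, by simp, by simp⟩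
    | succ i ih =>
      intro hi
      obtain ⟨ℓ, s, C, h, sw, hst, hℓ, hs, hℓi, hsi, hC⟩ := ih (by omega)
      have e1 : ℓ ≤ (12 * X) ^ X := hℓi.trans (Nat.pow_le_pow_right (by omega) (by omega))
      have e2 : s ≤ (2700 * X ^ 4) ^ X :=
        hsi.trans (Nat.pow_le_pow_right (by positivity) (by omega))
      have hnum' : 2400 * X ^ 5 * (X + 1) * (200 * X ^ 4) ^ X * (ℓ * s) ≤ k :=
        (Nat.mul_le_mul_left _ (Nat.mul_le_mul e1 e2)).trans hnum
      obtain ⟨T, hT1, hT2, hT3, hT4, hT5, hT6, hT7, hT8, hT9⟩ :=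
        hst.exists_sparse_darts hE hM hm hmn hπ hS hk hX hk4 hkX hnX hℓ hs hnum'
      obtain ⟨C', h', sw', hst', hC'⟩ := hst.exists_next hEs hE hM hmax
        (by positivity : 0 < 100 * X ^ 4 + 200 * X ^ 3) hk hX (by omega) hT1 hT2 hT3 hT4 hT5 hT6
        hT7 hT8 hT9
      have hB1 : 1 ≤ 100 * X ^ 4 + 200 * X ^ 3 := Nat.succ_le_of_lt (by positivity)
      have hB2 : 100 * X ^ 4 + 200 * X ^ 3 ≤ 300 * X ^ 4 := by
        have : X ^ 3 ≤ X ^ 4 := Nat.pow_le_pow_right (by omega) (by omega)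
        omega
      generalize 100 * X ^ 4 + 200 * X ^ 3 = B at *
      refine ⟨_, _, C', h', sw', hst', ?_, ?_, ?_, ?_, ?_⟩
      · exact Nat.succ_le_of_lt (by positivity)
      · omega
      · calc (X + 1) * (5 + ℓ) ≤ (2 * X) * (6 * ℓ) := Nat.mul_le_mul (by omega) (by omega)
          _ = ℓ * (12 * X) := by ring
          _ ≤ (12 * X) ^ i * (12 * X) := Nat.mul_le_mul_right _ hℓi
          _ = _ := (pow_succ _ _).symm
      · have e3 : 1 * 1 ≤ B * s := Nat.mul_le_mul hB1 hs
        have e4 : 1 * s ≤ B * s := Nat.mul_le_mul_right _ hB1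
        calc s + (4 + 4 * B * s) ≤ s * (9 * B) := by nlinarith
          _ ≤ (2700 * X ^ 4) ^ i * (2700 * X ^ 4) := Nat.mul_le_mul hsi (by omega)
          _ = _ := (pow_succ _ _).symm
      · rw [Nat.add_mul]
        omega
  obtain ⟨ℓ, s, C, h, sw, -, -, -, -, -, hC⟩ := hiter X le_rfl
  have := card_le_univ C
  omega

/-- The left side is exp(O(X log X)): it is at most the X-th power of a polynomial of degree 15,
which is eventually below e^(X/8). -/
lemma eventually_stage_bound_le : ∀ᶠ X : ℕ in atTop,
    (2400 * (X : ℝ) ^ 5 * (X + 1) * (200 * (X : ℝ) ^ 4) ^ X *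
      ((12 * X) ^ X * (2700 * (X : ℝ) ^ 4) ^ X)) ≤ Real.exp (((X : ℝ) - 1) ^ 2 / 2) := by
  have h0 : Tendsto (fun X : ℕ => (X : ℝ) / 8) atTop atTop :=
    tendsto_natCast_atTop_atTop.atTop_div_const (by norm_num)
  have h1 := ((Real.tendsto_exp_div_pow_atTop 15).comp h0).eventually_ge_atTop
    (4800 * 6480000 * 8 ^ 15)
  filter_upwards [h1, eventually_ge_atTop 2] with X hX hX2
  have hXr : (2 : ℝ) ≤ X := by exact_mod_cast hX2
  simp only [Function.comp_apply] at hX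
  rw [le_div_iff₀ (by positivity), div_pow] at hX
  have h2 : 4800 * 6480000 * (X : ℝ) ^ 15 ≤ Real.exp ((X : ℝ) / 8) := by
    refine le_trans (le_of_eq ?_) hX
    field_simp
  have h3 : (4800 * (X : ℝ) ^ 6) ≤ (4800 * (X : ℝ) ^ 6) ^ X := by
    refine le_self_pow₀ ?_ (by omega)
    have := one_le_pow₀ (n := 6) (by linarith : (1 : ℝ) ≤ X)
    linarith
  calc _ ≤ 2400 * (X : ℝ) ^ 5 * (2 * X) * (200 * (X : ℝ) ^ 4) ^ X *
      ((12 * X) ^ X * (2700 * (X : ℝ) ^ 4) ^ X) := by gcongr; linarith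
    _ = (4800 * (X : ℝ) ^ 6) * ((200 * (X : ℝ) ^ 4) * ((12 * X) * (2700 * (X : ℝ) ^ 4))) ^ X := by
        rw [mul_pow (200 * (X : ℝ) ^ 4), mul_pow (12 * (X : ℝ)) (2700 * (X : ℝ) ^ 4)]; ring
    _ ≤ (4800 * (X : ℝ) ^ 6) ^ X *
        ((200 * (X : ℝ) ^ 4) * ((12 * X) * (2700 * (X : ℝ) ^ 4))) ^ X := by gcongr
    _ = (4800 * 6480000 * (X : ℝ) ^ 15) ^ X := by rw [← mul_pow]; ring
    _ ≤ Real.exp ((X : ℝ) / 8) ^ X := by gcongr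
    _ = Real.exp (X * (X / 8)) := (Real.exp_nat_mul _ _).symm
    _ ≤ _ := Real.exp_le_exp.2 (by nlinarith)

/-- A family of `n` graphs of small multiplicity, each with a permutation of the vertices that maps
many vertices to their neighbours, has an almost perfect rainbow matching. -/
theorem exists_large_rainbow_finset : ∃ n₀ : ℕ, ∀ n : ℕ, n₀ ≤ n → ∀ (m : ℕ) (V κ : Type*)
    [Fintype V] [Fintype κ] (E : κ → V → V → Prop) (π : κ → Equiv.Perm V) (S : κ → Finset V),
    Fintype.card κ = n → m ≤ n → (∀ c u v, E c u v → E c v u) → (∀ c v, ¬ E c v v) →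
    (∀ u v, u ≠ v → #(univ.filter fun c => E c u v) ≤ m) → (∀ c, ∀ v ∈ S c, E c v (π c v)) →
    (∀ c, 2 * n + 2 * m ≤ #(S c)) →
    ∃ M, IsRainbowFinset E M ∧ (n : ℝ) - 1001 * n / Real.sqrt (Real.log n) ≤ #M := by
  have hlim : Tendsto (fun n : ℕ => ⌈Real.sqrt (Real.log n)⌉₊) atTop atTop :=
    tendsto_nat_ceil_atTop.comp (Real.tendsto_sqrt_atTop.comp
      (Real.tendsto_log_atTop.comp tendsto_natCast_atTop_atTop))
  obtain ⟨n₀, hn₀⟩ := eventually_atTop.1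
    ((hlim.eventually eventually_stage_bound_le).and (eventually_ge_atTop 3))
  refine ⟨n₀, fun n hn m V κ _ _ E π S hκ hmn hEs hE hm hπ hS => ?_⟩
  obtain ⟨hstage, hn3⟩ := hn₀ n hn
  obtain ⟨M, hM, hmax⟩ := Finset.exists_max_image
    (univ.filter fun X : Finset (κ × V × V) => IsRainbowFinset E X) card
    ⟨∅, mem_filter.2 ⟨mem_univ _, by simp, by simp⟩⟩
  have hM := (mem_filter.1 hM).2
  refine ⟨M, hM, ?_⟩
  by_contra! hlt
  have hMn : #M ≤ n := by
    rw [← hκ, ← card_image_of_injOn hM.injOn_colour]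
    exact card_le_univ _
  obtain ⟨k, hk⟩ := Nat.exists_eq_add_of_le hMn
  have hn3r : (3 : ℝ) ≤ n := by exact_mod_cast hn3
  have hn0 : (0 : ℝ) < n := by linarith
  set L := Real.log n with hL
  have hL1 : 1 ≤ L := by
    rw [hL, Real.le_log_iff_exp_le hn0]
    linarith [Real.exp_one_lt_three]
  set q := Real.sqrt L with hq
  have hq1 : 1 ≤ q := Real.one_le_sqrt.2 hL1
  have hqq : q ^ 2 = L := Real.sq_sqrt (by linarith)
  -- Rounding up gives log n ≤ X², while (X - 1)² ≤ log n keeps the stage bound below √n.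
  set X := ⌈q⌉₊ with hX
  have hXq : q ≤ X := Nat.le_ceil q
  have hXq1 : (X : ℝ) < q + 1 := Nat.ceil_lt_add_one (by linarith)
  have hkr : 1001 * (n : ℝ) / q < k := by
    have : (n : ℝ) = #M + k := by exact_mod_cast hk
    linarith
  have hX1r : (1 : ℝ) ≤ X := by linarith
  have hX1 : 1 ≤ X := by exact_mod_cast hX1r
  have hexpL : Real.exp L = n := Real.exp_log hn0
  -- The chain is exp((X - 1)²/2) ≤ √n ≤ n/√log n ≤ k.
  have hnumr : Real.exp (((X : ℝ) - 1) ^ 2 / 2) ≤ k := by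
    have h1 : Real.exp (((X : ℝ) - 1) ^ 2 / 2) ≤ Real.exp (L / 2) :=
      Real.exp_le_exp.2 (by nlinarith)
    have h2 : q ≤ Real.exp (L / 2) := by
      have := Real.add_one_le_exp (L / 2)
      nlinarith [sq_nonneg (q - 1)]
    have h3 : Real.exp (L / 2) * Real.exp (L / 2) = n := by
      rw [← Real.exp_add, add_halves, hexpL]
    have h4 : Real.exp (L / 2) ≤ n / q := by
      rw [le_div_iff₀ (by linarith), ← h3]
      gcongr
    have h5 : (n : ℝ) / q ≤ 1001 * n / q := by gcongr; linarith
    linarith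
  have hnum : 2400 * X ^ 5 * (X + 1) * (200 * X ^ 4) ^ X *
      ((12 * X) ^ X * (2700 * X ^ 4) ^ X) ≤ k := by
    have := hstage.trans hnumr
    exact_mod_cast this
  have hk4 : 4 ≤ k := by
    refine le_trans ?_ hnum
    have e1 : 1 ≤ (200 * X ^ 4) ^ X := Nat.one_le_pow _ _ (by positivity)
    have e2 : 1 ≤ (12 * X) ^ X := Nat.one_le_pow _ _ (by positivity)
    have e3 : 1 ≤ (2700 * X ^ 4) ^ X := Nat.one_le_pow _ _ (by positivity)
    have e4 : 1 ≤ X ^ 5 := Nat.one_le_pow _ _ hX1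
    calc 4 ≤ 2400 * 1 * (0 + 1) * 1 * (1 * 1) := by norm_num
      _ ≤ _ := by gcongr; omega
  have hlt' := card_add_le_of_isMaximum hEs hE hM
    (fun Y hY => hmax Y (mem_filter.2 ⟨mem_univ _, hY⟩)) hm (by omega) hπ
    (by rwa [hκ]) (hκ ▸ hk.symm) hX1 hk4 (by rw [hκ, ← hexpL]; exact Real.exp_le_exp.2 (by nlinarith))
    hnum
  rw [hκ] at hlt'
  have h1 : (X : ℝ) * k < 100 * n := by exact_mod_cast hlt'
  have h2 : 1001 * (n : ℝ) < k * q := (div_lt_iff₀ (by linarith)).1 hkr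
  have h3 : (k : ℝ) * q ≤ k * X := by gcongr
  linarith

end RainbowFinsets

/-! ### From coloured cliques to permutations, and back to multigraphs. -/

section Cliques

/-- Each member is permuted by a single cycle, which has no fixed point since the member is
nontrivial; all other points stay fixed. -/
lemma exists_perm_of_pairwiseDisjoint {V : Type*} [Finite V] {P : Set (Set V)}
    (hP : P.PairwiseDisjoint id) (hnt : ∀ S ∈ P, S.Nontrivial) :
    ∃ π : Equiv.Perm V, ∀ S ∈ P, ∀ x ∈ S, π x ∈ S ∧ π x ≠ x := by
  classical
  have hcyc : ∀ S : Set V, ∃ f : Equiv.Perm V, f.IsCycleOn S := fun S =>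
    S.to_countable.exists_cycleOn.imp fun _ h => h.1
  choose f hf using hcyc
  have huniq : ∀ S ∈ P, ∀ T ∈ P, ∀ x ∈ S, x ∈ T → S = T := by
    intro S hS T hT x hxS hxT
    by_contra hne
    exact Set.disjoint_left.1 (hP hS hT hne) hxS hxT
  let g : V → V := fun x => if h : ∃ S ∈ P, x ∈ S then f h.choose x else x
  have hg : ∀ S ∈ P, ∀ x ∈ S, g x = f S x := by
    intro S hS x hx
    have h : ∃ S ∈ P, x ∈ S := ⟨S, hS, hx⟩
    have h1 := h.choose_spec
    simp only [g, dif_pos h]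
    rw [huniq _ h1.1 S hS x h1.2 hx]
  have hg' : ∀ x, (¬ ∃ S ∈ P, x ∈ S) → g x = x := fun x hx => dif_neg hx
  have hmem : ∀ S ∈ P, ∀ x, g x ∈ S ↔ x ∈ S := by
    intro S hS x
    by_cases h : ∃ T ∈ P, x ∈ T
    · obtain ⟨T, hT, hx⟩ := h
      rw [hg T hT x hx]
      constructor
      · intro h1
        rwa [huniq S hS T hT _ h1 ((hf T).apply_mem_iff.2 hx)]
      · intro h1
        obtain rfl := huniq S hS T hT x h1 hx
        exact (hf S).apply_mem_iff.2 hx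
    · rw [hg' x h]
  have hinj : Function.Injective g := by
    intro x y hxy
    by_cases h : ∃ S ∈ P, x ∈ S
    · obtain ⟨S, hS, hx⟩ := h
      have hy : y ∈ S := by rwa [← hmem S hS, ← hxy, hmem S hS]
      rw [hg S hS x hx, hg S hS y hy] at hxy
      exact (f S).injective hxy
    · have h' : ¬ ∃ S ∈ P, y ∈ S := by
        rintro ⟨S, hS, hy⟩
        exact h ⟨S, hS, by rwa [← hmem S hS, hxy, hmem S hS]⟩
      rwa [hg' x h, hg' y h'] at hxy
  refine ⟨Equiv.ofBijective g (Finite.injective_iff_bijective.1 hinj), fun S hS x hx =>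
    ⟨(hmem S hS x).2 hx, ?_⟩⟩
  change g x ≠ x
  rw [hg S hS x hx]
  exact (hf S).apply_ne (hnt S hS) hx

lemma Graph.IsDisjointUnionOfCliques.exists_perm {α β : Type*} {H : Graph α β}
    (hH : H.IsDisjointUnionOfCliques) (hfin : V(H).Finite) :
    ∃ π : Equiv.Perm V(H), ∀ v : V(H), v.1 ∈ H.spannedVerts → H.Adj v.1 (π v).1 := by
  obtain ⟨-, P, hP, hnt, hadj⟩ := hH
  have : Finite V(H) := hfin
  set Q : Set (Set V(H)) := (fun S => Subtype.val ⁻¹' S) '' P with hQ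
  have hQd : Q.PairwiseDisjoint id := by
    rintro _ ⟨S, hS, rfl⟩ _ ⟨T, hT, rfl⟩ hne
    exact (hP hS hT fun h => hne (by rw [h])).preimage _
  have hQn : ∀ S ∈ Q, S.Nontrivial := by
    rintro _ ⟨S, hS, rfl⟩
    obtain ⟨x, hx, y, hy, hxy⟩ := hnt S hS
    obtain ⟨e, he⟩ := (hadj x y).2 ⟨hxy, S, hS, hx, hy⟩
    exact ⟨⟨x, he.left_mem⟩, hx, ⟨y, he.right_mem⟩, hy, fun h => hxy (congrArg Subtype.val h)⟩
  obtain ⟨π, hπ⟩ := exists_perm_of_pairwiseDisjoint hQd hQn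
  refine ⟨π, fun v ⟨e, y, hy⟩ => ?_⟩
  obtain ⟨-, S, hS, hv, -⟩ := (hadj v.1 y).1 ⟨e, hy⟩
  obtain ⟨h1, h2⟩ := hπ _ ⟨S, hS, rfl⟩ v hv
  exact (hadj _ _).2 ⟨fun h => h2 (Subtype.ext h.symm), S, hS, hv, h1⟩

open scoped Classical in
lemma Graph.MultiplicityAtMost.card_colours_le {α β κ : Type*} [Fintype κ] {G : Graph α β} {m : ℕ}
    (hG : G.MultiplicityAtMost m) (c : β → κ) (x y : α) :
    (Finset.univ.filter fun i => (G.colourClass c i).Adj x y).card ≤ m := by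
  have h : ∀ i, (G.colourClass c i).Adj x y → ∃ e, c e = i ∧ G.IsLink e x y :=
    fun i ⟨e, he⟩ => ⟨e, he.1, he.2⟩
  rcases isEmpty_or_nonempty β with hβ | hβ
  · rw [Finset.card_eq_zero.2]
    · exact Nat.zero_le m
    · exact Finset.filter_eq_empty_iff.2 fun i _ ⟨e, _⟩ => hβ.elim e
  choose! f hf using h
  have h1 : ((Finset.univ.filter fun i => (G.colourClass c i).Adj x y : Finset κ) :
      Set κ).encard ≤ {e | G.IsLink e x y}.encard := by
    refine Set.encard_le_encard_of_injOn (f := f) (fun i hi => ?_) fun i hi j hj hij => ?_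
    · exact (hf i (Finset.mem_filter.1 hi).2).2
    · rw [← (hf i (Finset.mem_filter.1 hi).2).1, hij, (hf j (Finset.mem_filter.1 hj).2).1]
  rw [Set.encard_coe_eq_coe_finsetCard] at h1
  exact_mod_cast h1.trans (hG x y)

/-- Each triple of a colour and two ends is realised by an actual edge; distinct triples have
distinct colours, hence distinct edges. -/
lemma IsRainbowFinset.exists_isRainbowMatching {α β κ : Type*} {G : Graph α β} {c : β → κ}
    {X : Finset (κ × V(G) × V(G))}
    (hX : IsRainbowFinset (fun i u v => (G.colourClass c i).Adj u.1 v.1) X) :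
    ∃ M : Set β, G.IsRainbowMatching c M ∧ M.ncard = X.card := by
  rcases X.eq_empty_or_nonempty with rfl | ⟨t₀, ht₀⟩
  · exact ⟨∅, ⟨Set.empty_subset _, by simp, Set.injOn_empty _⟩, by simp⟩
  obtain ⟨e₀, -⟩ := hX.edge t₀ ht₀
  have : Nonempty β := ⟨e₀⟩
  have h : ∀ t ∈ X, ∃ e, c e = t.1 ∧ G.IsLink e t.2.1 t.2.2 := fun t ht => hX.edge t ht
  choose! f hf using h
  have hinj : Set.InjOn f X := fun s hs t ht hst => hX.injOn_colour hs ht (by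
    rw [← (hf s hs).1, ← (hf t ht).1, hst])
  have hmem : ∀ t ∈ X, ∀ x, G.Inc (f t) x → ∃ v : V(G), v.1 = x ∧ Sum.inl v ∈ edgeItems t := by
    intro t ht x hx
    rcases hx.eq_or_eq_of_isLink (hf t ht).2 with rfl | rfl
    · exact ⟨t.2.1, rfl, inl_mem_edgeItems.2 (Or.inl rfl)⟩
    · exact ⟨t.2.2, rfl, inl_mem_edgeItems.2 (Or.inr rfl)⟩
  refine ⟨f '' X, ⟨?_, ?_, ?_⟩, ?_⟩
  · rintro _ ⟨t, ht, rfl⟩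
    exact (hf t ht).2.edge_mem
  · rintro _ ⟨s, hs, rfl⟩ _ ⟨t, ht, rfl⟩ hne x hx hx'
    obtain ⟨v, rfl, hv⟩ := hmem s hs x hx
    obtain ⟨w, hw, hw'⟩ := hmem t ht _ hx'
    rw [Subtype.ext hw] at hw'
    exact hne (by rw [hX.eq_of_mem hs ht hv hw'])
  · rintro _ ⟨s, hs, rfl⟩ _ ⟨t, ht, rfl⟩ hst
    rw [(hf s hs).1, (hf t ht).1] at hst
    rw [hX.injOn_colour hs ht hst]
  · rw [hinj.ncard_image, Set.ncard_coe_finset]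

end Cliques

theorem theorem4p1 :
    ∃ n₀ : ℕ, ∀ n : ℕ, n₀ ≤ n → ∀ (m : ℕ) (α : Type*) (β : Type*) (G : Graph α β)
      (c : β → Fin n),
      G.IsColouredCliqueMultigraph c (2 * (n : ℝ) + 2 * (m : ℝ) + (n : ℝ) ^ ((3 : ℝ) / 4)) →
      G.MultiplicityAtMost m →
      ∃ M : Set β, G.IsRainbowMatching c M ∧
        (n : ℝ) - 1001 * (n : ℝ) / Real.sqrt (Real.log (n : ℝ)) ≤ (M.ncard : ℝ) := by
  classical
  obtain ⟨n₀, hn₀⟩ := exists_large_rainbow_finset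
  refine ⟨n₀, fun n hn m α β G c hG hm => ?_⟩
  have : Fintype V(G) := hG.finite_vertexSet.fintype
  have hperm : ∀ i, ∃ π : Equiv.Perm V(G), ∀ v : V(G), v.1 ∈ (G.colourClass c i).spannedVerts →
      (G.colourClass c i).Adj v.1 (π v).1 := fun i =>
    (hG.cliques i).exists_perm hG.finite_vertexSet
  choose π hπ using hperm
  -- Multiplicity is now counted in colours, of which there are only n. Hence `min m n` can replace
  -- m, which secures m ≤ n.
  have hS : ∀ i, 2 * n + 2 * min m n ≤ (Finset.univ.filter fun v : V(G) =>
      v.1 ∈ (G.colourClass c i).spannedVerts).card := by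
    intro i
    have h1 : (G.colourClass c i).spannedVerts.ncard =
        (Finset.univ.filter fun v : V(G) => v.1 ∈ (G.colourClass c i).spannedVerts).card := by
      rw [← Set.ncard_coe_finset, ← Set.ncard_image_of_injective _ Subtype.val_injective]
      congr 1
      ext x
      simp only [Finset.coe_filter, Finset.mem_univ, true_and, Set.mem_image, Set.mem_ofPred_eq]
      refine ⟨fun hx => ⟨⟨x, ?_⟩, hx, rfl⟩, ?_⟩
      · obtain ⟨e, y, hy⟩ := hx
        exact hy.2.left_mem
      · rintro ⟨v, hv, rfl⟩
        exact hv
    have h2 := hG.le_card i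
    rw [h1] at h2
    have h3 : (0 : ℝ) ≤ (n : ℝ) ^ ((3 : ℝ) / 4) := by positivity
    have h4 : 2 * n + 2 * m ≤
        (Finset.univ.filter fun v : V(G) => v.1 ∈ (G.colourClass c i).spannedVerts).card := by
      have : (2 * n + 2 * m : ℝ) ≤ (Finset.univ.filter fun v : V(G) =>
        v.1 ∈ (G.colourClass c i).spannedVerts).card := by linarith
      exact_mod_cast this
    have h5 := min_le_left m n
    omega
  obtain ⟨X, hX, hcard⟩ := hn₀ n hn (min m n) V(G) (Fin n)
    (fun i u v => (G.colourClass c i).Adj u.1 v.1) π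
    (fun i => Finset.univ.filter fun v => v.1 ∈ (G.colourClass c i).spannedVerts)
    (Fintype.card_fin n) (min_le_right _ _) (fun i u v ⟨e, he⟩ => ⟨e, he.symm⟩)
    (fun i v ⟨e, he⟩ => by
      have := (hG.cliques i).1
      exact (G.colourClass c i).not_isLoopAt e v.1 he)
    (fun u v _ => le_min (by convert hm.card_colours_le c u.1 v.1)
      ((Finset.card_le_univ _).trans_eq (Fintype.card_fin n)))
    (fun i v hv => hπ i v (Finset.mem_filter.1 hv).2) hS
  obtain ⟨M, hM, hMX⟩ := hX.exists_isRainbowMatching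
  exact ⟨M, hM, by rwa [hMX]⟩
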